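/- **Setting.** There are $m\ge 1$ identical servers with $C\ge 1$ units of resource each ($C$ an integer) and $n$ threads with utility functions $f_1,\dots,f_n$ that are nonnegative, nondecreasing and concave on $[0,C]$. A super-optimal allocation is a vector $(\hat c_1,\dots,\hat c_n)$ with $\hat c_i\in[0,C]$ that maximizes $\sum_i f_i(\hat c_i)$ subject to $\sum_i\hat c_i\le mC$; resources are handed out in whole units, so the $\hat c_i$ are integers and the maximum is over integer vectors. Put $g_i(x)=f_i(\hat c_i)\,x/\hat c_i$ for $x<\hat c_i$ and $g_i(x)=f_i(\hat c_i)$ otherwise. **Algorithm 2.** (0) Compute a super-optimal allocation by Galil's algorithm: select the $mC$ largest among the marginal utilities $f_i(k+1)-f_i(k)$, $0\le k<C$, which form $n$ sorted sequences, by repeatedly taking the median (found in linear time) of the middle elements of the remaining intervals as a pivot and locating it in all the intervals by binary search. (1) Sort the threads in nonincreasing order of $g_i(\hat c_i)$. (2) Re-sort those from position $m+1$ on in nonincreasing order of $g_i(\hat c_i)/\hat c_i$ (read as $0$ if $\hat c_i=0$). Both sorts are merge sorts. (3) Put $C_1=\dots=C_m=C$ into a max-heap. (4) For each thread $i$ in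 this order: let $j$ be the server at the top of the heap, i.e. with the largest $C_j$; set $c_i=\min(\hat c_i,C_j)$ and $r_i=j$; replace $C_j$ by $C_j-c_i$ and update the heap. Return the pairs $(r_i,c_i)$. The running time is the number of steps on a unit-cost machine: each evaluation of an $f_i$ at an integer, each arithmetic operation or comparison on integers or reals, and each call of a (recursive) procedure is one step. **Theorem.** (a) For all $m,C\ge 1$, all $n\ge 0$ and all such $f_i$, this implementation returns the result of a run of (1)–(4), with some breaking of ties, on an integer super-optimal allocation $\hat c$. If moreover every $f_i$ is affine on each interval $[k,k+1]$, $0\le k<C$, then $\hat c$ is also super-optimal among all real allocations. (b) If $\log n=O((\log mC)^2)$, then Algorithm 2, including step (0), runs in $O(n(\log mC)^2)$ time. Precisely: for each real $K$ there is a real $K'$ such that for all $1\le m\le n$, all $C$ with $mC\ge 2$, and all such $f_i$, if $\log n\le K(\log mC)^2$ then the running time is at most $K'\,n\,(\log mC)^2$. -/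

import Mathlib

namespace AA

noncomputable section

/-! ### The problem -/

/-- A utility function on `[0, C]`: nonnegative, nondecreasing and concave. -/
structure IsUtility (C : ℕ) (f : ℝ → ℝ) : Prop where
  nonneg : ∀ x ∈ Set.Icc (0 : ℝ) C, 0 ≤ f x
  mono : MonotoneOn f (Set.Icc (0 : ℝ) C)
  concave : ConcaveOn ℝ (Set.Icc (0 : ℝ) C) f

/-- `f` is affine between consecutive whole numbers of resource units. -/
def AffineOnUnits (C : ℕ) (f : ℝ → ℝ) : Prop :=
  ∀ k : ℕ, k < C → ∀ t ∈ Set.Icc (0 : ℝ) 1,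
    f (k + t) = (1 - t) * f k + t * f (k + 1)

/-- `x` is a super-optimal allocation when the admissible amounts are the members of `S`
(`S = Set.univ`: divisible resources; `S = Set.range Nat.cast`: whole units). -/
structure IsSuperOptimal {n : ℕ} (S : Set ℝ) (m C : ℕ) (f : Fin n → ℝ → ℝ)
    (x : Fin n → ℝ) : Prop where
  mem : ∀ i, x i ∈ Set.Icc (0 : ℝ) C ∩ S
  budget : ∑ i, x i ≤ (m : ℝ) * C
  optimal : ∀ y : Fin n → ℝ, (∀ i, y i ∈ Set.Icc (0 : ℝ) C ∩ S) →
    ∑ i, y i ≤ (m : ℝ) * C → ∑ i, f i (y i) ≤ ∑ i, f i (x i)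

/-- The linearized utility function of `f` at the super-optimal amount `a`. -/
def linearized (f : ℝ → ℝ) (a x : ℝ) : ℝ :=
  if x < a then f a * (x / a) else f a

/-- What Algorithm 2 does on the super-optimal allocation `chat`, ties being broken arbitrarily:
thread `σ k` is the `k`-th one processed; thread `i` receives `c i` units on server `r i`.
(For `chat i = 0` the quotient in `resort` is `0`; such a thread receives nothing anyway.) -/
structure IsRun {n : ℕ} (m C : ℕ) (f : Fin n → ℝ → ℝ) (chat : Fin n → ℕ)
    (σ : Equiv.Perm (Fin n)) (r : Fin n → Fin m) (c : Fin n → ℕ) : Prop where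
  /-- the first `m` threads are the first `m` in nonincreasing order of `g_i(chat i)` -/
  sort : ∃ τ : Equiv.Perm (Fin n),
    Antitone (fun k => linearized (f (τ k)) (chat (τ k)) (chat (τ k))) ∧
    ∀ k : Fin n, (k : ℕ) < m → σ k = τ k
  /-- the other threads come in nonincreasing order of `g_i(chat i) / chat i` -/
  resort : ∀ k l : Fin n, m ≤ (k : ℕ) → k ≤ l →
    linearized (f (σ l)) (chat (σ l)) (chat (σ l)) / (chat (σ l) : ℝ) ≤
      linearized (f (σ k)) (chat (σ k)) (chat (σ k)) / (chat (σ k) : ℝ)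
  /-- the main loop; `R k j` is what is left on server `j` before the `k`-th iteration -/
  loop : ∃ R : ℕ → Fin m → ℕ, (∀ j, R 0 j = C) ∧ ∀ k : Fin n,
    (∀ j, R k j ≤ R k (r (σ k))) ∧
    c (σ k) = min (chat (σ k)) (R k (r (σ k))) ∧
    R (k + 1) = Function.update (R k) (r (σ k)) (R k (r (σ k)) - c (σ k))

/-! ### Counting steps

The programs below work on pointer structures (lists, trees, records) on a unit-cost machine. One
step is charged for each call of a recursive procedure, each evaluation of a utility function at a
whole number, and each arithmetic operation or comparison. The `fuel` arguments
only make a recursion structural: they are always large enough and are not part of the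
computation. -/

/-- A result together with the number of steps spent on it. -/
structure Timed (α : Type) where
  ret : α
  time : ℕ

instance : Monad Timed where
  pure a := ⟨a, 0⟩
  bind x g := ⟨(g x.ret).ret, x.time + (g x.ret).time⟩

/-- Spend `k` steps. -/
def tick (k : ℕ) : Timed Unit := ⟨(), k⟩

/-- Perform one elementary operation, with result `a`. -/
def step {α : Type} (a : α) : Timed α := ⟨a, 1⟩

/-! ### Lists, sorting, selection -/

def length {α : Type} : List α → Timed ℕ
  | [] => do
    tick 1
    return 0
  | _ :: l => do
    tick 1
    let k ← length l
    step (k + 1)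

def append {α : Type} : List α → List α → Timed (List α)
  | [], l' => do
    tick 1
    return l'
  | a :: l, l' => do
    tick 1
    let s ← append l l'
    return a :: s

/-- The first `k` members of a list, and the others. -/
def splitAt {α : Type} : ℕ → List α → Timed (List α × List α)
  | 0, l => do
    tick 1
    return ([], l)
  | _ + 1, [] => do
    tick 1
    return ([], [])
  | k + 1, a :: l => do
    tick 2
    let s ← splitAt k l
    return (a :: s.1, s.2)

/-- Entry number `k` (counted from `0`) of a list of reals. -/
def nth : List ℝ → ℕ → Timed ℝ
  | [], _ => do
    tick 1
    return 0
  | a :: _, 0 => do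
    tick 1
    return a
  | _ :: l, k + 1 => do
    tick 2
    nth l k

/-- Deal a list out into two halves. -/
def deal {α : Type} : List α → Timed (List α × List α)
  | [] => do
    tick 1
    return ([], [])
  | [a] => do
    tick 1
    return ([a], [])
  | a :: b :: l => do
    tick 1
    let s ← deal l
    return (a :: s.1, b :: s.2)

/-- Merge two lists that are nonincreasing in `key`. -/
def merge {α : Type} (key : α → ℝ) : List α → List α → Timed (List α)
  | [], l' => do
    tick 1
    return l'
  | a :: l, [] => do
    tick 1
    return a :: l
  | a :: l, b :: l' => do
    tick 1
    if (← step (decide (key b ≤ key a))) then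
      let s ← merge key l (b :: l')
      return a :: s
    else
      let s ← merge key (a :: l) l'
      return b :: s
termination_by l l' => l.length + l'.length

def mergeSortAux {α : Type} (key : α → ℝ) : (fuel : ℕ) → List α → Timed (List α)
  | 0, l => return l
  | _ + 1, [] => do
    tick 1
    return []
  | _ + 1, [a] => do
    tick 1
    return [a]
  | fuel + 1, a :: b :: l => do
    tick 1
    let s ← deal (a :: b :: l)
    let x ← mergeSortAux key fuel s.1
    let y ← mergeSortAux key fuel s.2
    merge key x y

/-- Merge sort, in nonincreasing order of `key`. -/
def mergeSort {α : Type} (key : α → ℝ) (l : List α) : Timed (List α) :=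
  mergeSortAux key l.length l

/-- The medians of consecutive groups of five (an incomplete last group is left out). -/
def groupMedians : List ℝ → Timed (List ℝ)
  | a :: b :: c :: d :: e :: l => do
    tick 1
    let s ← mergeSort id [a, b, c, d, e]
    let x ← nth s 2
    let t ← groupMedians l
    return x :: t
  | _ => do
    tick 1
    return []

/-- The entries greater than `p`, the number of entries equal to `p`, the entries less than `p`. -/
def partition (p : ℝ) : List ℝ → Timed (List ℝ × ℕ × List ℝ)
  | [] => do
    tick 1
    return ([], 0, [])
  | a :: l => do
    tick 1
    let s ← partition p l
    if (← step (decide (p < a))) then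
      return (a :: s.1, s.2.1, s.2.2)
    else if (← step (decide (a < p))) then
      return (s.1, s.2.1, a :: s.2.2)
    else
      let e ← step (s.2.1 + 1)
      return (s.1, e, s.2.2)

def selectAux : (fuel : ℕ) → ℕ → List ℝ → Timed ℝ
  | 0, _, _ => return 0
  | fuel + 1, k, l => do
    tick 1
    let len ← length l
    if (← step (decide (len ≤ 100))) then
      let s ← mergeSort id l
      nth s k
    else
      let meds ← groupMedians l
      let lenMeds ← length meds
      let half ← step (lenMeds / 2)
      let p ← selectAux fuel half meds
      let s ← partition p l
      let above ← length s.1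
      let upTo ← step (above + s.2.1)
      if (← step (decide (k < above))) then
        selectAux fuel k s.1
      else if (← step (decide (k < upTo))) then
        return p
      else
        let k' ← step (k - upTo)
        selectAux fuel k' s.2.2

/-- Deterministic linear-time selection (median of medians): the entry that has number `k`, counted
from `0`, when `l` is put in nonincreasing order. -/
def select (k : ℕ) (l : List ℝ) : Timed ℝ :=
  selectAux l.length k l

/-! ### The super-optimal allocation by Galil's algorithm

Giving thread `i` one unit more than `k` units gains the marginal utility `f i (k + 1) - f i k`,
which is nonincreasing in `k`. The algorithm selects the `m * C` largest ones in the union of these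
`n` sorted sequences: it keeps for each thread an interval in which the amount is still searched,
takes the median of the marginal utilities at the midpoints of the open intervals as the pivot, and
locates the pivot in each of the sequences by binary search. -/

/-- Evaluate a utility function at a whole number. -/
def query (f : ℝ → ℝ) (k : ℕ) : Timed ℝ := step (f k)

/-- The marginal utility of unit number `k` (counted from `0`). -/
def marginal (f : ℝ → ℝ) (k : ℕ) : Timed ℝ := do
  let k' ← step (k + 1)
  let y ← query f k'
  let x ← query f k
  step (y - x)

/-- Binary search in `[lo, hi]` for the first `k` whose marginal utility fails the test `keep`. -/
def cut (f : ℝ → ℝ) (keep : ℝ → Bool) (lo hi : ℕ) : Timed ℕ := do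
  tick 2
  if _h : lo < hi then
    tick 2
    let mid := (lo + hi) / 2
    let d ← marginal f mid
    if (← step (keep d)) then
      tick 1
      cut f keep (mid + 1) hi
    else
      cut f keep lo mid
  else
    return lo
termination_by hi - lo

/-- Thread `thread` will get between `lo` and `hi` units. -/
structure Interval (n : ℕ) where
  thread : Fin n
  lo : ℕ
  hi : ℕ

/-- An interval, with the numbers of units whose marginal utility is greater than the pivot
(`gt`), or at least the pivot (`ge`). -/
structure Located (n : ℕ) where
  seg : Interval n
  gt : ℕ
  ge : ℕ

/-- Thread `thread` gets `amount` units. -/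
structure Share (n : ℕ) where
  thread : Fin n
  amount : ℕ

def initial {n : ℕ} (C : ℕ) : List (Fin n) → Timed (List (Interval n))
  | [] => do
    tick 1
    return []
  | i :: l => do
    tick 1
    let s ← initial C l
    return ⟨i, 0, C⟩ :: s

/-- The marginal utilities at the midpoints. -/
def midpoints {n : ℕ} (f : Fin n → ℝ → ℝ) : List (Interval n) → Timed (List ℝ)
  | [] => do
    tick 1
    return []
  | s :: l => do
    tick 1
    let t ← step (s.lo + s.hi)
    let mid ← step (t / 2)
    let d ← marginal (f s.thread) mid
    let ds ← midpoints f l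
    return d :: ds

/-- Locate the pivot `p` in all intervals; also return the sums of the two kinds of counts. -/
def locate {n : ℕ} (f : Fin n → ℝ → ℝ) (p : ℝ) :
    List (Interval n) → Timed (List (Located n) × ℕ × ℕ)
  | [] => do
    tick 1
    return ([], 0, 0)
  | s :: l => do
    tick 1
    let a ← cut (f s.thread) (fun d => decide (p < d)) s.lo s.hi
    let b ← cut (f s.thread) (fun d => decide (p ≤ d)) s.lo s.hi
    let t ← locate f p l
    let sumA ← step (a + t.2.1)
    let sumB ← step (b + t.2.2)
    return (⟨s, a, b⟩ :: t.1, sumA, sumB)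

/-- Replace each interval by a new one; put those that have become a point into the list
`closed` of finished threads, whose amounts have the sum `total`. -/
def refine {n : ℕ} (new : Located n → Interval n) :
    List (Located n) → List (Share n) → ℕ → Timed (List (Interval n) × List (Share n) × ℕ)
  | [], closed, total => do
    tick 1
    return ([], closed, total)
  | s :: l, closed, total => do
    tick 1
    if (← step (decide ((new s).lo < (new s).hi))) then
      let t ← refine new l closed total
      return (new s :: t.1, t.2)
    else
      let total' ← step (total + (new s).lo)
      refine new l (⟨s.seg.thread, (new s).lo⟩ :: closed) total'

/-- Give each thread the units above the pivot, and share `rest` further units out among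
those that equal it. -/
def share {n : ℕ} : List (Located n) → ℕ → List (Share n) → Timed (List (Share n))
  | [], _, closed => do
    tick 1
    return closed
  | s :: l, rest, closed => do
    tick 1
    let ties ← step (s.ge - s.gt)
    let x ← step (min rest ties)
    let amount ← step (s.gt + x)
    let rest' ← step (rest - x)
    share l rest' (⟨s.seg.thread, amount⟩ :: closed)

def galilAux {n : ℕ} (f : Fin n → ℝ → ℝ) (N : ℕ) : (fuel : ℕ) →
    List (Interval n) → List (Share n) → ℕ → Timed (List (Share n))
  | 0, _, closed, _ => return closed
  | _ + 1, [], closed, _ => do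
    tick 1
    return closed
  | fuel + 1, s :: l, closed, total => do
    tick 1
    let ds ← midpoints f (s :: l)
    let len ← length ds
    let half ← step (len / 2)
    let p ← select half ds
    let t ← locate f p (s :: l)
    let sumA ← step (total + t.2.1)
    let sumB ← step (total + t.2.2)
    if (← step (decide (N < sumA))) then
      let u ← refine (fun z => ⟨z.seg.thread, z.seg.lo, z.gt⟩) t.1 closed total
      galilAux f N fuel u.1 u.2.1 u.2.2
    else if (← step (decide (sumB < N))) then
      let u ← refine (fun z => ⟨z.seg.thread, z.ge, z.seg.hi⟩) t.1 closed total
      galilAux f N fuel u.1 u.2.1 u.2.2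
    else
      let rest ← step (N - sumA)
      share t.1 rest closed

/-- The super-optimal allocation for `m` servers with `C` units each. -/
def galil {n : ℕ} (m C : ℕ) (f : Fin n → ℝ → ℝ) : Timed (List (Share n)) := do
  let N ← step (m * C)
  let segs ← initial C (List.finRange n)
  galilAux f N (n * C + 1) segs [] 0

/-! ### The max-heap of servers -/

/-- A binary tree whose nodes carry the amount left on a server, and the server. -/
inductive Heap where
  | leaf : Heap
  | node (left : ℕ) (server : ℕ) (l r : Heap) : Heap

def Heap.rootLeft : Heap → ℕ
  | .leaf => 0
  | .node R _ _ _ => R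

def Heap.rootServer : Heap → ℕ
  | .leaf => 0
  | .node _ j _ _ => j

/-- The root of the heap, if there is one, is at most `R`. -/
def Heap.rootLe : Heap → ℕ → Bool
  | .leaf, _ => true
  | .node R' _ _ _, R => decide (R' ≤ R)

/-- The balanced heap of the servers `j, …, j + k - 1`, with `C` units left on each. -/
def Heap.build (C j k : ℕ) : Timed Heap := do
  tick 1
  if _h : k = 0 then
    return .leaf
  else
    tick 5
    let a := (k - 1) / 2
    let l ← Heap.build C (j + 1) a
    let r ← Heap.build C (j + 1 + a) (k - 1 - a)
    return .node C j l r
termination_by k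

/-- Replace the root by `(R, j)` and sift it down. -/
def Heap.replaceRoot (R j : ℕ) : Heap → Timed Heap
  | .leaf => do
    tick 1
    return .leaf
  | .node _ _ l r => do
    tick 1
    let okL ← step (l.rootLe R)
    let okR ← step (r.rootLe R)
    if okL && okR then
      return .node R j l r
    else if (← step (r.rootLe l.rootLeft)) then
      let l' ← Heap.replaceRoot R j l
      return .node l.rootLeft l.rootServer l' r
    else
      let r' ← Heap.replaceRoot R j r
      return .node r.rootLeft r.rootServer l r'

/-! ### Algorithm 2 -/

/-- Thread `thread` with `chat = ĉ_i`, `value = g_i(ĉ_i)` and `slope = g_i(ĉ_i) / ĉ_i`. -/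
structure Job (n : ℕ) where
  thread : Fin n
  chat : ℕ
  value : ℝ
  slope : ℝ

/-- Thread `thread`, with super-optimal amount `chat`, gets `amount` units on server `server`. -/
structure Assigned (n : ℕ) where
  thread : Fin n
  chat : ℕ
  server : ℕ
  amount : ℕ

/-- Note that `g_i(ĉ_i) = f_i(ĉ_i)`. -/
def jobs {n : ℕ} (f : Fin n → ℝ → ℝ) : List (Share n) → Timed (List (Job n))
  | [] => do
    tick 1
    return []
  | s :: l => do
    tick 1
    let g ← query (f s.thread) s.amount
    let q ← step (g / s.amount)
    let t ← jobs f l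
    return ⟨s.thread, s.amount, g, q⟩ :: t

/-- The main loop. -/
def assign {n : ℕ} : List (Job n) → Heap → Timed (List (Assigned n))
  | [], _ => do
    tick 1
    return []
  | _ :: _, .leaf => do
    tick 1
    return []
  | i :: l, .node R j hl hr => do
    tick 1
    let c ← step (min i.chat R)
    let R' ← step (R - c)
    let H ← Heap.replaceRoot R' j (.node R j hl hr)
    let t ← assign l H
    return ⟨i.thread, i.chat, j, c⟩ :: t

/-- Algorithm 2, including the computation of the super-optimal allocation. The records are
listed in the order in which the threads are processed. -/
def algorithm2 {n : ℕ} (m C : ℕ) (f : Fin n → ℝ → ℝ) : Timed (List (Assigned n)) := do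
  let shares ← galil m C f
  let js ← jobs f shares
  let sorted ← mergeSort Job.value js
  let parts ← splitAt m sorted
  let tail ← mergeSort Job.slope parts.2
  let order ← append parts.1 tail
  let H ← Heap.build C 0 m
  assign order H

end

end AA

/-! Correctness of step (0) is Lagrangian duality. By concavity the gains `gain f k` of one thread
are nonincreasing in `k`, so for a threshold `p` the units of gain above `p`, or at least `p`, form
an initial segment of every thread, and binary search finds its end. The loop keeps for every thread
an interval of candidate amounts (`Bracket`). Across all threads, units before the lower ends gain
strictly more than those after, and the same holds at the upper ends. The lower ends use at most `N`
units, and the upper ends use more than `N` unless all of them equal `C`. A pivot either replaces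
all upper ends, or all lower ends, or is itself the right threshold. In the last case its ties are
shared out, and the pivot is a price at which each thread's amount maximizes utility minus cost
(`Bracket.isPrice`). If all intervals shrink to points instead, every thread has `C` units and the
price is `0` (`isPrice_of_closed`). A nonnegative price together with an exhausted budget or price
`0` proves optimality (`Supported.isSuperOptimal`). For utilities affine on unit intervals the price
inequality extends from integers to reals by interpolation, so the same argument covers all real
allocations.

The running time of step (0) is measured by the potential `bits`, the total bit length of the
interval widths, which starts at `n * C.size`. A round with `L` open intervals costs `O(L *
C.size)`. The pivot is a median of the midpoint gains, so whichever ends move, at least `L / 2`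
intervals lose half of their width, hence a bit. The rounds therefore cost `O(n * C.size ^ 2)` in
total (`galilAux_spec`); linear-time selection (`selectAux_spec`) keeps the median from dominating.

The remaining steps are two merge sorts and `n` updates of a heap whose depth stays at most
`m.size`, which adds `O(n log n + n log m)`. The assumption on `log n` absorbs the sorting term.
Correctness of the main loop reduces to the root of a valid heap being its maximum
(`Heap.replaceRoot_spec`, `assign_spec`). -/

namespace AA

/-! ### Timed computations -/

section Timed

variable {α β : Type}

@[simp] lemma ret_pure (a : α) : (pure a : Timed α).ret = a := rfl
@[simp] lemma time_pure (a : α) : (pure a : Timed α).time = 0 := rfl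
@[simp] lemma ret_bind (x : Timed α) (g : α → Timed β) : (x >>= g).ret = (g x.ret).ret := rfl
@[simp] lemma time_bind (x : Timed α) (g : α → Timed β) :
    (x >>= g).time = x.time + (g x.ret).time := rfl
@[simp] lemma ret_step (a : α) : (step a).ret = a := rfl
@[simp] lemma time_step (a : α) : (step a).time = 1 := rfl
@[simp] lemma time_tick (k : ℕ) : (tick k).time = k := rfl
@[simp] lemma ret_ite (p : Prop) [Decidable p] (x y : Timed α) :
    (if p then x else y).ret = if p then x.ret else y.ret := by split_ifs <;> rfl
@[simp] lemma time_ite (p : Prop) [Decidable p] (x y : Timed α) :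
    (if p then x else y).time = if p then x.time else y.time := by split_ifs <;> rfl

end Timed

/-! ### Lists and merge sort -/

section Lists

variable {α : Type}

@[simp] lemma ret_length (l : List α) : (length l).ret = l.length := by
  induction l with
  | nil => rfl
  | cons a l ih => simp [length, ih]

@[simp] lemma time_length (l : List α) : (length l).time = 2 * l.length + 1 := by
  induction l with
  | nil => rfl
  | cons a l ih => simp [length, ih]; ring

@[simp] lemma ret_append (l l' : List α) : (append l l').ret = l ++ l' := by
  induction l with
  | nil => rfl
  | cons a l ih => simp [append, ih]

@[simp] lemma time_append (l l' : List α) : (append l l').time = l.length + 1 := by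
  induction l with
  | nil => rfl
  | cons a l ih => simp [append, ih]; ring

@[simp] lemma ret_splitAt (k : ℕ) (l : List α) : (splitAt k l).ret = (l.take k, l.drop k) := by
  induction l generalizing k with
  | nil => cases k <;> simp [splitAt]
  | cons a l ih => cases k <;> simp [splitAt, ih]

lemma time_splitAt_le (k : ℕ) (l : List α) : (splitAt k l).time ≤ 2 * l.length + 1 := by
  induction l generalizing k with
  | nil => cases k <;> simp [splitAt]
  | cons a l ih =>
    cases k with
    | zero => simp [splitAt]
    | succ k => have := ih k; simp [splitAt]; omega

@[simp] lemma ret_nth (l : List ℝ) (k : ℕ) : (nth l k).ret = l.getD k 0 := by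
  induction l generalizing k with
  | nil => simp [nth]
  | cons a l ih => cases k <;> simp [nth, ih]

lemma time_nth_le (l : List ℝ) (k : ℕ) : (nth l k).time ≤ 2 * l.length + 1 := by
  induction l generalizing k with
  | nil => simp [nth]
  | cons a l ih =>
    cases k with
    | zero => simp [nth]
    | succ k => have := ih k; simp [nth]; omega

lemma deal_spec : ∀ l : List α, ((deal l).ret.1 ++ (deal l).ret.2).Perm l ∧
    (deal l).ret.1.length = (l.length + 1) / 2 ∧ (deal l).ret.2.length = l.length / 2 ∧
    (deal l).time ≤ l.length / 2 + 1
  | [] => by simp [deal]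
  | [a] => by simp [deal]
  | a :: b :: l => by
    obtain ⟨h1, h2, h3, h4⟩ := deal_spec l
    refine ⟨?_, ?_, ?_, ?_⟩
    · simp only [deal, ret_bind, ret_pure, List.cons_append]
      exact (List.perm_middle.trans (h1.cons b)).cons a
    all_goals simp [deal, h2, h3]; omega

lemma merge_perm (key : α → ℝ) (l l' : List α) : (merge key l l').ret.Perm (l ++ l') := by
  fun_induction merge key l l' with
  | case1 => simp
  | case2 => simp
  | case3 a l b l' ih1 ih2 =>
    simp only [ret_bind, ret_step, decide_eq_true_eq, ret_ite, ret_pure]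
    split_ifs
    · exact ih1.cons a
    · exact (ih2.cons b).trans List.perm_middle.symm

lemma merge_time_le (key : α → ℝ) (l l' : List α) :
    (merge key l l').time ≤ 2 * (l.length + l'.length) + 1 := by
  fun_induction merge key l l' with
  | case1 => simp
  | case2 => simp
  | case3 a l b l' ih1 ih2 =>
    simp only [time_bind, ret_step, decide_eq_true_eq, time_ite, time_pure, time_step, time_tick,
      List.length_cons] at *
    split_ifs <;> omega

/-- The list is nonincreasing in `key`. -/
def Decreasing (key : α → ℝ) (l : List α) : Prop := l.Pairwise fun a b => key b ≤ key a

lemma merge_decreasing (key : α → ℝ) (l l' : List α) (h : Decreasing key l)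
    (h' : Decreasing key l') : Decreasing key (merge key l l').ret := by
  fun_induction merge key l l' with
  | case1 => simpa
  | case2 => simpa
  | case3 a l b l' ih1 ih2 =>
    simp only [ret_bind, ret_step, decide_eq_true_eq, ret_ite, ret_pure]
    obtain ⟨ha, hl⟩ := List.pairwise_cons.1 h
    obtain ⟨hb, hl'⟩ := List.pairwise_cons.1 h'
    split_ifs with hab
    · refine List.pairwise_cons.2 ⟨fun x hx => ?_, ih1 hl h'⟩
      rcases List.mem_append.1 ((merge_perm key l (b :: l')).mem_iff.1 hx) with hx | hx
      · exact ha x hx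
      · rcases List.mem_cons.1 hx with rfl | hx
        · exact hab
        · exact (hb x hx).trans hab
    · refine List.pairwise_cons.2 ⟨fun x hx => ?_, ih2 h hl'⟩
      rcases List.mem_append.1 ((merge_perm key (a :: l) l').mem_iff.1 hx) with hx | hx
      · rcases List.mem_cons.1 hx with rfl | hx
        · exact (not_le.1 hab).le
        · exact (ha x hx).trans (not_le.1 hab).le
      · exact hb x hx

lemma mergeSortAux_spec (key : α → ℝ) (fuel : ℕ) (l : List α) (hl : l.length ≤ fuel) :
    (mergeSortAux key fuel l).ret.Perm l ∧ Decreasing key (mergeSortAux key fuel l).ret ∧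
    (mergeSortAux key fuel l).time ≤ 5 * (l.length * Nat.clog 2 l.length) + 1 := by
  induction fuel generalizing l with
  | zero =>
    obtain rfl := List.length_eq_zero_iff.1 (Nat.le_zero.1 hl)
    simp [mergeSortAux, Decreasing]
  | succ fuel ih =>
    match l with
    | [] => simp [mergeSortAux, Decreasing]
    | [a] => simp [mergeSortAux, Decreasing]
    | a :: b :: l =>
      obtain ⟨h1, h2, h3, h4⟩ := deal_spec (a :: b :: l)
      simp only [mergeSortAux, ret_bind, time_bind, time_tick]
      generalize (deal (a :: b :: l)).ret = s at *
      generalize hL : (a :: b :: l).length = L at *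
      have hL2 : 2 ≤ L := by simp at hL; omega
      obtain ⟨p1, q1, t1⟩ := ih s.1 (by omega)
      obtain ⟨p2, q2, t2⟩ := ih s.2 (by omega)
      have hm := merge_time_le key (mergeSortAux key fuel s.1).ret (mergeSortAux key fuel s.2).ret
      refine ⟨(merge_perm key _ _).trans ((p1.append p2).trans h1),
        merge_decreasing key _ _ q1 q2, ?_⟩
      rw [p1.length_eq, p2.length_eq, h2, h3] at hm
      rw [h2] at t1
      rw [h3] at t2
      -- Both halves have ceiling logarithm at most `Nat.clog 2 L - 1`. The extra level leaves `5 *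
      -- L` steps for dealing and merging, which need about `5 * L / 2` plus a constant; `2 ≤ L`
      -- absorbs the constant.
      have hc : Nat.clog 2 L = Nat.clog 2 ((L + 1) / 2) + 1 := Nat.clog_of_two_le (by omega) hL2
      have hc' : Nat.clog 2 (L / 2) ≤ Nat.clog 2 ((L + 1) / 2) :=
        Nat.clog_mono_right 2 (by omega)
      rw [hc]
      have e1 : L / 2 * Nat.clog 2 (L / 2) ≤ L / 2 * Nat.clog 2 ((L + 1) / 2) :=
        Nat.mul_le_mul_left _ hc'
      have e2 : (L + 1) / 2 * Nat.clog 2 ((L + 1) / 2) + L / 2 * Nat.clog 2 ((L + 1) / 2) =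
          L * Nat.clog 2 ((L + 1) / 2) := by
        rw [← add_mul]; congr 1; omega
      rw [mul_add, mul_one]
      omega

lemma mergeSort_perm (key : α → ℝ) (l : List α) : (mergeSort key l).ret.Perm l :=
  (mergeSortAux_spec key _ l le_rfl).1

lemma mergeSort_decreasing (key : α → ℝ) (l : List α) : Decreasing key (mergeSort key l).ret :=
  (mergeSortAux_spec key _ l le_rfl).2.1

lemma mergeSort_time_le (key : α → ℝ) (l : List α) :
    (mergeSort key l).time ≤ 5 * (l.length * Nat.clog 2 l.length) + 1 :=
  (mergeSortAux_spec key _ l le_rfl).2.2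

end Lists

/-! ### Selection -/

lemma ret_partition (p : ℝ) (l : List ℝ) : (partition p l).ret =
    (l.filter (p < ·), l.countP (p = ·), l.filter (· < p)) := by
  induction l with
  | nil => rfl
  | cons a l ih =>
    simp only [partition, ret_bind, ret_step, ret_ite, ret_pure, ih, decide_eq_true_eq]
    rcases lt_trichotomy p a with h | h | h
    · simp [h, h.ne, h.not_gt]
    · simp [h]
    · simp [h, h.ne', h.not_gt]

lemma time_partition_le (p : ℝ) (l : List ℝ) : (partition p l).time ≤ 4 * l.length + 1 := by
  induction l with
  | nil => simp [partition]
  | cons a l ih =>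
    simp only [partition, time_bind, time_step, time_ite, time_pure, time_tick, List.length_cons]
    split_ifs <;> omega

/-- `q` has number `k`, counted from `0`, when `l` is put in nonincreasing order. -/
def HasRank (k : ℕ) (l : List ℝ) (q : ℝ) : Prop :=
  l.countP (q < ·) ≤ k ∧ k < l.countP (q ≤ ·)

lemma hasRank_getD_of_decreasing {l : List ℝ} (h : Decreasing id l) {k : ℕ} (hk : k < l.length) :
    HasRank k l (l.getD k 0) := by
  rw [List.getD_eq_getElem _ _ hk]
  have hp := List.pairwise_iff_getElem.1 h
  generalize hx : l[k] = x
  constructor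
  · conv_lhs => rw [← List.take_append_drop k l]
    rw [List.countP_append, (List.countP_eq_zero (l := l.drop k)).2, add_zero]
    · exact List.countP_le_length.trans (by simp)
    · intro a ha
      obtain ⟨i, hi, rfl⟩ := List.mem_iff_getElem.1 ha
      subst hx
      rw [List.getElem_drop]
      rcases Nat.eq_zero_or_pos i with rfl | hi0
      · simp
      · simpa using hp k (k + i) hk (by simp at hi; omega) (by omega)
  · conv_rhs => rw [← List.take_append_drop (k + 1) l]
    rw [List.countP_append, (List.countP_eq_length (l := l.take (k + 1))).2]
    · simp; omega
    · intro a ha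
      obtain ⟨i, hi, rfl⟩ := List.mem_iff_getElem.1 ha
      subst hx
      rw [List.getElem_take]
      have hi' : i < k + 1 := by simp at hi; omega
      rcases Nat.lt_succ_iff_lt_or_eq.1 hi' with hi0 | rfl
      · simpa using hp i k (by omega) hk hi0
      · simp

lemma HasRank.exists_le {k : ℕ} {l : List ℝ} {q : ℝ} (h : HasRank k l q) : ∃ a ∈ l, q ≤ a := by
  simpa using List.countP_pos_iff.1 (Nat.zero_le k |>.trans_lt h.2)

lemma HasRank.exists_ge {k : ℕ} {l : List ℝ} {q : ℝ} (h : HasRank k l q) (hk : k < l.length) :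
    ∃ a ∈ l, a ≤ q := by
  by_contra! hc
  have : l.countP (q < ·) = l.length := List.countP_eq_length.2 (by simpa using hc)
  have := h.1
  omega

lemma countP_lt_add_countP_le (p : ℝ) (l : List ℝ) :
    l.countP (p < ·) + l.countP (· ≤ p) = l.length := by
  induction l with
  | nil => rfl
  | cons a l ih =>
    by_cases h : p < a
    · simp [h, ← ih]; omega
    · simp [h, not_lt.1 h, ← ih]; omega

lemma countP_lt_add_countP_eq (p : ℝ) (l : List ℝ) :
    l.countP (p < ·) + l.countP (p = ·) = l.countP (p ≤ ·) := by
  induction l with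
  | nil => rfl
  | cons a l ih =>
    rcases lt_trichotomy p a with h | h | h
    · simp [h, h.ne, h.le, ← ih]; omega
    · subst h; simp [← ih]; omega
    · simp [h.ne', h.not_gt, h.not_ge, ← ih]

lemma countP_le_add_countP_lt (p : ℝ) (l : List ℝ) :
    l.countP (p ≤ ·) + l.countP (· < p) = l.length := by
  induction l with
  | nil => rfl
  | cons a l ih =>
    by_cases h : p ≤ a
    · simp [h, h.not_gt, ← ih]; omega
    · simp [h, not_le.1 h, ← ih]; omega

lemma countP_le_eq_add_of_lt {p q : ℝ} (h : q < p) (l : List ℝ) :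
    l.countP (q ≤ ·) = l.countP (p ≤ ·) + (l.filter (· < p)).countP (q ≤ ·) ∧
    l.countP (q < ·) = l.countP (p ≤ ·) + (l.filter (· < p)).countP (q < ·) := by
  induction l with
  | nil => simp
  | cons a l ih =>
    by_cases hp : p ≤ a
    · simp [hp, hp.not_gt, h.le.trans hp, h.trans_le hp, ih.1, ih.2]; omega
    · by_cases h1 : q ≤ a <;> by_cases h2 : q < a <;>
        simp [hp, not_le.1 hp, h1, h2, ih.1, ih.2] <;> omega

/-- Some kept entry is at most `q`, so `p < q`. The entries discarded are then below `q` and enter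
neither count. -/
lemma HasRank.of_filter_gt {k : ℕ} {l : List ℝ} {p q : ℝ} (h : HasRank k (l.filter (p < ·)) q)
    (hk : k < l.countP (p < ·)) : HasRank k l q := by
  rw [List.countP_eq_length_filter] at hk
  obtain ⟨a, ha, haq⟩ := h.exists_ge hk
  have hpq : p < q := (by simpa using (List.mem_filter.1 ha).2 : p < a).trans_le haq
  constructor
  · refine le_trans (le_of_eq ?_) h.1
    rw [List.countP_filter]
    refine List.countP_congr fun x _ => ?_
    simpa using fun hx => hpq.trans hx
  · refine h.2.trans_eq ?_
    rw [List.countP_filter]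
    refine List.countP_congr fun x _ => ?_
    simpa using fun hx => hpq.trans_le hx

/-- Some kept entry is at least `q`, so `q < p`. Each discarded entry is then above `q` and shifts
both counts by one. -/
lemma HasRank.of_filter_lt {k : ℕ} {l : List ℝ} {p q : ℝ}
    (h : HasRank (k - l.countP (p ≤ ·)) (l.filter (· < p)) q)
    (hk : l.countP (p ≤ ·) ≤ k) : HasRank k l q := by
  obtain ⟨a, ha, haq⟩ := h.exists_le
  have hqp : q < p := haq.trans_lt (by simpa using (List.mem_filter.1 ha).2)
  obtain ⟨h1, h2⟩ := countP_le_eq_add_of_lt hqp l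
  have := h.1
  have := h.2
  constructor <;> omega

lemma three_mul_le_countP_of_five {s : List ℝ} (h : Decreasing id s) (hs : s.length = 5)
    (P : ℝ → Bool) (hP : (∀ x y, x ≤ y → P x → P y) ∨ ∀ x y, x ≤ y → P y → P x)
    (h2 : P (s.getD 2 0)) : 3 ≤ s.countP P := by
  match s, hs with
  | [a, b, c, d, e], _ =>
    simp only [Decreasing, id, List.pairwise_cons, List.mem_cons, forall_eq_or_imp] at h
    simp only [List.getD_cons_succ, List.getD_cons_zero] at h2
    rcases hP with hP | hP
    · simp [hP c b h.2.1.1 h2, hP c a h.1.2.1 h2, h2, List.countP_cons]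
    · simp [hP d c h.2.2.1.1 h2, hP e c h.2.2.1.2.1 h2, h2, List.countP_cons]
      omega

/-- A median satisfying a monotone condition brings two more members of its group with it. Allowing
both directions of monotonicity gives the bound for the entries at least the pivot and for those at
most the pivot. The factor `20` pays for a group of five: at most `76` steps of sorting, `11` of
lookup and one call. -/
lemma groupMedians_spec : ∀ l : List ℝ, (groupMedians l).ret.length = l.length / 5 ∧
    (groupMedians l).time ≤ 20 * l.length + 1 ∧
    ∀ P : ℝ → Bool, ((∀ x y, x ≤ y → P x → P y) ∨ ∀ x y, x ≤ y → P y → P x) →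
      3 * (groupMedians l).ret.countP P ≤ l.countP P
  | a :: b :: c :: d :: e :: l => by
    obtain ⟨h1, h2, h3⟩ := groupMedians_spec l
    simp only [groupMedians, ret_bind, time_bind, time_tick, ret_nth, ret_pure, time_pure]
    have hp := mergeSort_perm id [a, b, c, d, e]
    have ht := mergeSort_time_le id [a, b, c, d, e]
    have hd := mergeSort_decreasing id [a, b, c, d, e]
    generalize (mergeSort id [a, b, c, d, e]).ret = s at *
    have hs : s.length = 5 := hp.length_eq
    refine ⟨by simp [h1]; omega, ?_, fun P hP => ?_⟩
    · have hc : Nat.clog 2 5 ≤ 3 := Nat.clog_le_of_le_pow (by norm_num)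
      have := time_nth_le s 2
      simp only [List.length_cons, List.length_nil, Nat.zero_add, Nat.reduceAdd] at *
      omega
    · have h4 := h3 P hP
      have h5 := three_mul_le_countP_of_five hd hs P hP
      have h6 : (a :: b :: c :: d :: e :: l).countP P = s.countP P + l.countP P := by
        rw [hp.countP_eq, ← List.countP_append]; rfl
      rw [h6, List.countP_cons]
      split_ifs with hx
      · have := h5 hx
        omega
      · omega
  | [] => by simp [groupMedians]
  | [_] => by simp [groupMedians]
  | [_, _] => by simp [groupMedians]
  | [_, _, _] => by simp [groupMedians]
  | [_, _, _, _] => by simp [groupMedians]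

/-- The median of medians has about three tenths of the list on either side of it, ties included.
The recursive calls thus see about `l.length / 5` and at most about `7 * l.length / 10` entries. At
`1000` steps per entry this leaves about a tenth of the budget for the linear work, and lengths
above `100` absorb rounding and constants. -/
lemma selectAux_spec (fuel k : ℕ) (l : List ℝ) (hl : l.length ≤ fuel) :
    (k < l.length → HasRank k l (selectAux fuel k l).ret) ∧
    (selectAux fuel k l).time ≤ 1000 * l.length + 10 := by
  induction fuel generalizing k l with
  | zero => simp [selectAux]; omega
  | succ fuel ih =>
    simp only [selectAux, ret_bind, ret_step, ret_ite, time_bind, time_step, time_ite, time_tick,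
      ret_length, time_length, decide_eq_true_eq, ret_nth]
    by_cases h100 : l.length ≤ 100
    · simp only [h100, if_true]
      have hp := mergeSort_perm id l
      constructor
      · intro hk
        have := hasRank_getD_of_decreasing (mergeSort_decreasing id l) (hp.length_eq ▸ hk)
        rwa [HasRank, hp.countP_eq, hp.countP_eq] at this
      · have h1 := mergeSort_time_le id l
        have h2 := time_nth_le (mergeSort id l).ret k
        rw [hp.length_eq] at h2
        have h3 : Nat.clog 2 l.length ≤ 7 := Nat.clog_le_of_le_pow (by omega)
        have := Nat.mul_le_mul_left l.length h3
        omega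
    · simp only [h100, if_false]
      obtain ⟨m1, m2, m3⟩ := groupMedians_spec l
      generalize (groupMedians l).ret = meds at *
      obtain ⟨r1, t1⟩ := ih (meds.length / 2) meds (by omega)
      replace r1 := r1 (by omega)
      generalize (selectAux fuel (meds.length / 2) meds).ret = p at *
      rw [ret_partition]
      have tp := time_partition_le p l
      have c1 := m3 (fun x => decide (p ≤ x)) (Or.inl fun x y h => by simpa using fun h' => h'.trans h)
      have c2 := m3 (fun x => decide (x ≤ p)) (Or.inr fun x y h => by simpa using h.trans)
      have c3 := countP_le_add_countP_lt p l
      have c4 := countP_lt_add_countP_le p l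
      have c5 := countP_lt_add_countP_le p meds
      have c6 := countP_lt_add_countP_eq p l
      have r2 := r1.1
      have r3 := r1.2
      simp only [← List.countP_eq_length_filter, c6]
      obtain ⟨g1, g2⟩ := ih k (l.filter (p < ·)) (by
        rw [← List.countP_eq_length_filter]; omega)
      obtain ⟨l1, l2⟩ := ih (k - l.countP (p ≤ ·)) (l.filter (· < p)) (by
        rw [← List.countP_eq_length_filter]; omega)
      rw [← List.countP_eq_length_filter] at g1 g2 l1 l2
      constructor
      · intro hk
        split_ifs with h1 h2 <;> try simp only [decide_eq_true_eq] at h2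
        · exact (g1 h1).of_filter_gt h1
        · exact ⟨not_lt.1 h1, h2⟩
        · exact (l1 (by omega)).of_filter_lt (not_lt.1 h2)
      · split_ifs <;> (try simp only [time_pure, time_bind, ret_step, time_step]) <;> omega

lemma select_hasRank {k : ℕ} {l : List ℝ} (hk : k < l.length) : HasRank k l (select k l).ret :=
  (selectAux_spec _ k l le_rfl).1 hk

lemma select_time_le (k : ℕ) (l : List ℝ) : (select k l).time ≤ 1000 * l.length + 10 :=
  (selectAux_spec _ k l le_rfl).2

/-! ### Marginal utilities -/

noncomputable section

/-- The marginal utility of unit number `k`, counted from `0`. -/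
def gain (f : ℝ → ℝ) (k : ℕ) : ℝ := f (k + 1 : ℕ) - f k

end

@[simp] lemma ret_marginal (f : ℝ → ℝ) (k : ℕ) : (marginal f k).ret = gain f k := rfl
@[simp] lemma time_marginal (f : ℝ → ℝ) (k : ℕ) : (marginal f k).time = 4 := rfl

lemma natCast_mem_Icc {k C : ℕ} (h : k ≤ C) : (k : ℝ) ∈ Set.Icc (0 : ℝ) C :=
  ⟨k.cast_nonneg, Nat.cast_le.2 h⟩

lemma IsUtility.gain_nonneg {C : ℕ} {f : ℝ → ℝ} (hf : IsUtility C f) {k : ℕ} (hk : k < C) :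
    0 ≤ gain f k :=
  sub_nonneg.2 <| hf.mono (natCast_mem_Icc hk.le) (natCast_mem_Icc hk) (by simp)

/-- Concavity is applied at `j + 1`, the midpoint of `j` and `j + 2`, and the inequality is chained
from `k` to `k'`. -/
lemma IsUtility.gain_anti {C : ℕ} {f : ℝ → ℝ} (hf : IsUtility C f) {k k' : ℕ} (h : k ≤ k')
    (hk' : k' < C) : gain f k' ≤ gain f k := by
  induction k', h using Nat.le_induction with
  | base => exact le_rfl
  | succ j hj ih =>
    refine le_trans ?_ (ih (by omega))
    have := hf.concave.2 (natCast_mem_Icc (by omega : j ≤ C)) (natCast_mem_Icc hk')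
      (by norm_num : (0 : ℝ) ≤ 1 / 2) (by norm_num : (0 : ℝ) ≤ 1 / 2) (by norm_num)
    have e : (1 / 2 : ℝ) • (j : ℝ) + (1 / 2 : ℝ) • ((j + 1 + 1 : ℕ) : ℝ) = (j + 1 : ℕ) := by
      push_cast; simp only [smul_eq_mul]; ring
    rw [e] at this
    simp only [smul_eq_mul] at this
    unfold gain
    linarith

/-! ### Bit lengths and binary search. -/

/-- Halving costs one bit. This bounds the depth of a binary search, the decrease of the potential
`bits`, and the depth of the heap. -/
lemma size_succ_le_of_le_half {x y : ℕ} (hx : 0 < x) (h : y ≤ x / 2) :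
    Nat.size y + 1 ≤ Nat.size x := by
  have hs : 0 < x.size := Nat.size_pos.2 hx
  have hlt : x < 2 ^ x.size := Nat.lt_size_self x
  have : y.size ≤ x.size - 1 := by
    rw [Nat.size_le]
    have : 2 ^ x.size = 2 * 2 ^ (x.size - 1) := by
      rw [← pow_succ', Nat.sub_add_cancel hs]
    omega
  omega

lemma cut_of_lt (f : ℝ → ℝ) (keep : ℝ → Bool) {lo hi : ℕ} (h : lo < hi) :
    (cut f keep lo hi).ret = (if keep (gain f ((lo + hi) / 2)) then
        (cut f keep ((lo + hi) / 2 + 1) hi).ret else (cut f keep lo ((lo + hi) / 2)).ret) ∧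
    (cut f keep lo hi).time ≤ 10 + (if keep (gain f ((lo + hi) / 2)) then
        (cut f keep ((lo + hi) / 2 + 1) hi).time else (cut f keep lo ((lo + hi) / 2)).time) := by
  rw [cut]
  by_cases hc : keep (gain f ((lo + hi) / 2)) = true
  · simp [h, hc]; omega
  · simp [h, hc]; omega

lemma cut_of_not_lt (f : ℝ → ℝ) (keep : ℝ → Bool) {lo hi : ℕ} (h : ¬lo < hi) :
    (cut f keep lo hi).ret = lo ∧ (cut f keep lo hi).time = 2 := by
  rw [cut]
  simp [h]

/-- The hypothesis makes the units passing the test an initial segment of `[lo, hi)`, so the outcome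
at `mid` decides one half of the interval. -/
lemma cut_spec (f : ℝ → ℝ) (keep : ℝ → Bool) (lo hi : ℕ) (h : lo ≤ hi)
    (hk : ∀ k k', lo ≤ k → k ≤ k' → k' < hi → keep (gain f k') → keep (gain f k)) :
    lo ≤ (cut f keep lo hi).ret ∧ (cut f keep lo hi).ret ≤ hi ∧
    (∀ k, lo ≤ k → k < hi → (k < (cut f keep lo hi).ret ↔ keep (gain f k))) := by
  induction hw : hi - lo using Nat.strong_induction_on generalizing lo hi with
  | _ w ih =>
    by_cases hlt : lo < hi
    · rw [(cut_of_lt f keep hlt).1]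
      generalize hmid : (lo + hi) / 2 = mid
      have hm : lo ≤ mid ∧ mid < hi := by omega
      split_ifs with hc
      · obtain ⟨h1, h2, h3⟩ := ih (hi - (mid + 1)) (by omega) (mid + 1) hi (by omega)
          (fun k k' a b => hk k k' (by omega) b) rfl
        refine ⟨by omega, h2, fun k ha hb => ?_⟩
        by_cases hkm : k ≤ mid
        · exact iff_of_true (by omega) (hk k mid ha hkm hm.2 hc)
        · exact h3 k (by omega) hb
      · obtain ⟨h1, h2, h3⟩ := ih (mid - lo) (by omega) lo mid hm.1
          (fun k k' a b c => hk k k' a b (by omega)) rfl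
        refine ⟨h1, by omega, fun k ha hb => ?_⟩
        by_cases hkm : k < mid
        · exact h3 k ha hkm
        · exact iff_of_false (by omega) fun hh => hc (hk mid k hm.1 (by omega) hb hh)
    · rw [(cut_of_not_lt f keep hlt).1]
      exact ⟨le_rfl, h, fun k _ _ => by omega⟩

lemma cut_time_le (f : ℝ → ℝ) (keep : ℝ → Bool) (lo hi : ℕ) :
    (cut f keep lo hi).time ≤ 10 * (hi - lo).size + 2 := by
  induction hw : hi - lo using Nat.strong_induction_on generalizing lo hi with
  | _ w ih =>
    by_cases hlt : lo < hi
    · have ht := (cut_of_lt f keep hlt).2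
      generalize hmid : (lo + hi) / 2 = mid at *
      have e1 := size_succ_le_of_le_half (x := w) (y := hi - (mid + 1)) (by omega) (by omega)
      have e2 := size_succ_le_of_le_half (x := w) (y := mid - lo) (by omega) (by omega)
      have t1 := ih (hi - (mid + 1)) (by omega) (mid + 1) hi rfl
      have t2 := ih (mid - lo) (by omega) lo mid rfl
      split_ifs at ht <;> omega
    · simp [(cut_of_not_lt f keep hlt).2]

/-! ### The parts of Galil's algorithm -/

section Parts

variable {n : ℕ}

lemma ret_initial (C : ℕ) (l : List (Fin n)) :
    (initial C l).ret = l.map fun i => ⟨i, 0, C⟩ := by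
  induction l with
  | nil => rfl
  | cons a l ih => simp [initial, ih]

lemma time_initial (C : ℕ) (l : List (Fin n)) : (initial C l).time = l.length + 1 := by
  induction l with
  | nil => rfl
  | cons a l ih => simp [initial, ih]; ring

lemma ret_midpoints (f : Fin n → ℝ → ℝ) (l : List (Interval n)) :
    (midpoints f l).ret = l.map fun s => gain (f s.thread) ((s.lo + s.hi) / 2) := by
  induction l with
  | nil => rfl
  | cons a l ih => simp [midpoints, ih]

lemma time_midpoints (f : Fin n → ℝ → ℝ) (l : List (Interval n)) :
    (midpoints f l).time = 7 * l.length + 1 := by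
  induction l with
  | nil => rfl
  | cons a l ih => simp [midpoints, ih]; ring

noncomputable section

/-- The number of units of `s.thread` above the pivot `p`, searched in the interval `s`. -/
def above (f : Fin n → ℝ → ℝ) (p : ℝ) (s : Interval n) : ℕ :=
  (cut (f s.thread) (fun d => decide (p < d)) s.lo s.hi).ret

/-- The number of units of `s.thread` not below the pivot `p`, searched in the interval `s`. -/
def upTo (f : Fin n → ℝ → ℝ) (p : ℝ) (s : Interval n) : ℕ :=
  (cut (f s.thread) (fun d => decide (p ≤ d)) s.lo s.hi).ret

end

lemma ret_locate (f : Fin n → ℝ → ℝ) (p : ℝ) (l : List (Interval n)) : (locate f p l).ret =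
    (l.map fun s => ⟨s, above f p s, upTo f p s⟩, (l.map (above f p)).sum,
      (l.map (upTo f p)).sum) := by
  induction l with
  | nil => rfl
  | cons a l ih => simp [locate, ih, above, upTo]

lemma time_locate_le (f : Fin n → ℝ → ℝ) (p : ℝ) (l : List (Interval n)) {b : ℕ}
    (hb : ∀ s ∈ l, (s.hi - s.lo).size ≤ b) :
    (locate f p l).time ≤ (20 * b + 7) * l.length + 1 := by
  induction l with
  | nil => simp [locate]
  | cons s l ih =>
    have h1 := cut_time_le (f s.thread) (fun d => decide (p < d)) s.lo s.hi
    have h2 := cut_time_le (f s.thread) (fun d => decide (p ≤ d)) s.lo s.hi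
    have h3 := ih fun t ht => hb t (by simp [ht])
    have h4 := hb s (by simp)
    simp only [locate, time_bind, time_tick, time_step, time_pure, List.length_cons, mul_add,
      mul_one]
    omega

/-- A finished thread as an interval. -/
def Share.toPoint (s : Share n) : Interval n := ⟨s.thread, s.amount, s.amount⟩

lemma refine_spec (new : Located n → Interval n) (l : List (Located n)) (closed : List (Share n))
    (total : ℕ) (hnew : ∀ z ∈ l, (new z).thread = z.seg.thread ∧ (new z).lo ≤ (new z).hi)
    (ht : total = (closed.map Share.amount).sum) :
    ((refine new l closed total).ret.1 ++ (refine new l closed total).ret.2.1.map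
      Share.toPoint).Perm (l.map new ++ closed.map Share.toPoint) ∧
    (∀ s ∈ (refine new l closed total).ret.1, s.lo < s.hi) ∧
    (refine new l closed total).ret.2.2 =
      ((refine new l closed total).ret.2.1.map Share.amount).sum ∧
    (refine new l closed total).time ≤ 3 * l.length + 1 := by
  induction l generalizing closed total with
  | nil => simp [refine, ht]
  | cons z l ih =>
    simp only [refine, ret_bind, time_bind, time_tick, ret_step, time_step, ret_ite, time_ite,
      decide_eq_true_eq]
    obtain ⟨hz1, hz2⟩ := hnew z (by simp)
    split_ifs with h
    · obtain ⟨h1, h2, h3, h4⟩ := ih closed total (fun z hz => hnew z (by simp [hz])) ht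
      simp only [ret_pure, time_pure, List.cons_append, List.map_cons]
      refine ⟨h1.cons _, ?_, h3, by simp; omega⟩
      simpa [h] using h2
    · obtain ⟨h1, h2, h3, h4⟩ := ih (⟨z.seg.thread, (new z).lo⟩ :: closed) (total + (new z).lo)
        (fun z hz => hnew z (by simp [hz])) (by simp [ht]; ring)
      refine ⟨h1.trans ?_, h2, h3, by simp; omega⟩
      have : Share.toPoint ⟨z.seg.thread, (new z).lo⟩ = new z := by
        rw [Share.toPoint, ← hz1]
        have : (new z).lo = (new z).hi := by omega
        cases hh : new z
        simp_all
      simp only [List.map_cons, this, List.cons_append]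
      exact List.perm_middle

lemma share_spec (l : List (Located n)) (rest : ℕ) (closed : List (Share n))
    (hl : ∀ z ∈ l, z.gt ≤ z.ge)
    (h : (l.map Located.gt).sum + rest ≤ (l.map Located.ge).sum) :
    (∃ l' : List (Share n), (share l rest closed).ret.Perm (l' ++ closed) ∧
      l'.map Share.thread = l.map (fun z => z.seg.thread) ∧
      (∀ s ∈ l', ∃ z ∈ l, s.thread = z.seg.thread ∧ z.gt ≤ s.amount ∧ s.amount ≤ z.ge) ∧
      (l'.map Share.amount).sum = (l.map Located.gt).sum + rest) := by
  induction l generalizing rest closed with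
  | nil => exact ⟨[], by simp [share], by simp, by simp, by simpa [eq_comm] using h⟩
  | cons z l ih =>
    simp only [share, ret_bind, ret_step]
    simp only [List.map_cons, List.sum_cons] at h ⊢
    have hz := hl z (by simp)
    have hs : (l.map Located.gt).sum ≤ (l.map Located.ge).sum :=
      List.sum_le_sum fun z hz => hl z (by simp [hz])
    obtain ⟨l', h1, h2, h4, h3⟩ := ih (rest - min rest (z.ge - z.gt))
      (⟨z.seg.thread, z.gt + min rest (z.ge - z.gt)⟩ :: closed)
      (fun z hz => hl z (by simp [hz])) (by omega)
    refine ⟨⟨z.seg.thread, z.gt + min rest (z.ge - z.gt)⟩ :: l', h1.trans List.perm_middle,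
      by simp [h2], ?_, by simp [h3]; omega⟩
    rintro s hs
    rcases List.mem_cons.1 hs with rfl | hs
    · exact ⟨z, by simp, rfl, by simp, by simp; omega⟩
    · obtain ⟨y, hy, h⟩ := h4 s hs
      exact ⟨y, by simp [hy], h⟩

lemma time_share (l : List (Located n)) (rest : ℕ) (closed : List (Share n)) :
    (share l rest closed).time = 5 * l.length + 1 := by
  induction l generalizing rest closed with
  | nil => simp [share]
  | cons z l ih => simp [share, ih]; ring

end Parts

/-! ### Galil's algorithm -/

section Galil

variable {n : ℕ} {f : Fin n → ℝ → ℝ} {C N : ℕ}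

/-- The intervals `L`, one for each thread, contain the amounts that the `N` units with the
largest marginal utilities amount to. -/
structure Bracket (f : Fin n → ℝ → ℝ) (C N : ℕ) (L : List (Interval n)) : Prop where
  le : ∀ s ∈ L, s.lo ≤ s.hi
  le_cap : ∀ s ∈ L, s.hi ≤ C
  lo_sep : ∀ s ∈ L, ∀ t ∈ L, ∀ k k', k < s.lo → t.lo ≤ k' → k' < C →
    gain (f t.thread) k' < gain (f s.thread) k
  hi_sep : ∀ s ∈ L, ∀ t ∈ L, ∀ k k', k < s.hi → t.hi ≤ k' → k' < C →
    gain (f t.thread) k' < gain (f s.thread) k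
  sum_lo : (L.map Interval.lo).sum ≤ N
  sum_hi : N < (L.map Interval.hi).sum ∨ ∀ s ∈ L, s.hi = C

lemma Bracket.perm {L L' : List (Interval n)} (h : Bracket f C N L) (hp : L'.Perm L) :
    Bracket f C N L' where
  le s hs := h.le s (hp.mem_iff.1 hs)
  le_cap s hs := h.le_cap s (hp.mem_iff.1 hs)
  lo_sep s hs t ht := h.lo_sep s (hp.mem_iff.1 hs) t (hp.mem_iff.1 ht)
  hi_sep s hs t ht := h.hi_sep s (hp.mem_iff.1 hs) t (hp.mem_iff.1 ht)
  sum_lo := (hp.map _).sum_eq.trans_le h.sum_lo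
  sum_hi := h.sum_hi.imp (fun h => h.trans_eq (hp.map _).sum_eq.symm)
    fun h s hs => h s (hp.mem_iff.1 hs)

/-- The pivot `p` lies between the marginal utilities of two units still in question. -/
structure IsPivot (f : Fin n → ℝ → ℝ) (C : ℕ) (L : List (Interval n)) (p : ℝ) : Prop where
  le : ∃ s ∈ L, ∃ k, s.lo ≤ k ∧ k < C ∧ p ≤ gain (f s.thread) k
  ge : ∃ s ∈ L, ∃ k, k < s.hi ∧ k < C ∧ gain (f s.thread) k ≤ p

section Pivot

variable {L : List (Interval n)} {p : ℝ}

lemma Bracket.above_mem (h : Bracket f C N L) (hf : ∀ i, IsUtility C (f i))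
    {s : Interval n} (hs : s ∈ L) :
    s.lo ≤ above f p s ∧ above f p s ≤ s.hi := by
  have := cut_spec (f s.thread) (fun d => decide (p < d)) s.lo s.hi (h.le s hs)
    fun k k' _ hk hk' => by
      simpa using fun hh => hh.trans_le ((hf _).gain_anti hk (hk'.trans_le (h.le_cap s hs)))
  exact ⟨this.1, this.2.1⟩

lemma Bracket.upTo_mem (h : Bracket f C N L) (hf : ∀ i, IsUtility C (f i))
    {s : Interval n} (hs : s ∈ L) :
    s.lo ≤ upTo f p s ∧ upTo f p s ≤ s.hi := by
  have := cut_spec (f s.thread) (fun d => decide (p ≤ d)) s.lo s.hi (h.le s hs)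
    fun k k' _ hk hk' => by
      simpa using fun hh => hh.trans ((hf _).gain_anti hk (hk'.trans_le (h.le_cap s hs)))
  exact ⟨this.1, this.2.1⟩

/-- The strictness in `lo_sep` is essential: a settled unit lies strictly above the pivot even if
the pivot equals the gain of an open unit. With `Bracket.gain_lt_of_hi_le`, a search confined to the
intervals therefore counts correctly over all units. -/
lemma Bracket.lt_gain_of_lt_lo (h : Bracket f C N L) (hp : IsPivot f C L p)
    {s : Interval n} (hs : s ∈ L) {k : ℕ} (hk : k < s.lo) :
    p < gain (f s.thread) k := by
  obtain ⟨t, ht, k', h1, h2, h3⟩ := hp.le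
  exact h3.trans_lt (h.lo_sep s hs t ht k k' hk h1 h2)

lemma Bracket.gain_lt_of_hi_le (h : Bracket f C N L) (hp : IsPivot f C L p)
    {s : Interval n} (hs : s ∈ L) {k : ℕ} (hk : s.hi ≤ k)
    (hkC : k < C) : gain (f s.thread) k < p := by
  obtain ⟨t, ht, k', h1, h2, h3⟩ := hp.ge
  exact (h.hi_sep t ht s hs k' k h1 hk hkC).trans_le h3

lemma Bracket.lt_above_iff (h : Bracket f C N L) (hf : ∀ i, IsUtility C (f i))
    (hp : IsPivot f C L p) {s : Interval n} (hs : s ∈ L) {k : ℕ} (hk : k < C) :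
    k < above f p s ↔ p < gain (f s.thread) k := by
  have hm := h.above_mem hf hs (p := p)
  rcases lt_or_ge k s.lo with h1 | h1
  · exact iff_of_true (by omega) (h.lt_gain_of_lt_lo hp hs h1)
  rcases lt_or_ge k s.hi with h2 | h2
  · have := (cut_spec (f s.thread) (fun d => decide (p < d)) s.lo s.hi (h.le s hs)
      fun k k' _ hk hk' => by
        simpa using fun hh => hh.trans_le
          ((hf _).gain_anti hk (hk'.trans_le (h.le_cap s hs)))).2.2 k h1 h2
    simpa [above] using this
  · exact iff_of_false (by omega) (h.gain_lt_of_hi_le hp hs h2 hk).not_gt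

lemma Bracket.lt_upTo_iff (h : Bracket f C N L) (hf : ∀ i, IsUtility C (f i))
    (hp : IsPivot f C L p) {s : Interval n} (hs : s ∈ L) {k : ℕ} (hk : k < C) :
    k < upTo f p s ↔ p ≤ gain (f s.thread) k := by
  have hm := h.upTo_mem hf hs (p := p)
  rcases lt_or_ge k s.lo with h1 | h1
  · exact iff_of_true (by omega) (h.lt_gain_of_lt_lo hp hs h1).le
  rcases lt_or_ge k s.hi with h2 | h2
  · have := (cut_spec (f s.thread) (fun d => decide (p ≤ d)) s.lo s.hi (h.le s hs)
      fun k k' _ hk hk' => by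
        simpa using fun hh => hh.trans
          ((hf _).gain_anti hk (hk'.trans_le (h.le_cap s hs)))).2.2 k h1 h2
    simpa [upTo] using this
  · exact iff_of_false (by omega) (h.gain_lt_of_hi_le hp hs h2 hk).not_ge

lemma Bracket.above_le_upTo (h : Bracket f C N L) (hf : ∀ i, IsUtility C (f i))
    (hp : IsPivot f C L p) {s : Interval n} (hs : s ∈ L) : above f p s ≤ upTo f p s := by
  by_contra! hc
  have h1 := h.above_mem hf hs (p := p)
  have h2 := h.le_cap s hs
  have h3 := (h.lt_above_iff hf hp hs (by omega)).1 hc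
  exact lt_irrefl _ ((h.lt_upTo_iff hf hp hs (by omega)).2 h3.le)

/-- The new upper ends separate gains above `p` from gains at most `p`, so `hi_sep` is again strict.
In `Bracket.raise_lo` the pivot itself falls on the upper side. -/
lemma Bracket.lower_hi (h : Bracket f C N L) (hf : ∀ i, IsUtility C (f i))
    (hp : IsPivot f C L p) (hN : N < (L.map (above f p)).sum) :
    Bracket f C N (L.map fun s => ⟨s.thread, s.lo, above f p s⟩) where
  le := by simpa using fun s hs => (h.above_mem hf hs).1
  le_cap := by simpa using fun s hs => (h.above_mem hf hs).2.trans (h.le_cap s hs)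
  lo_sep := by simpa using h.lo_sep
  hi_sep := by
    simp only [List.forall_mem_map]
    intro s hs t ht k k' hk hk' hC
    have h1 := (h.above_mem hf hs (p := p)).2.trans (h.le_cap s hs)
    exact (not_lt.1 fun hh => hk'.not_gt ((h.lt_above_iff hf hp ht hC).2 hh)).trans_lt
      ((h.lt_above_iff hf hp hs (hk.trans_le h1)).1 hk)
  sum_lo := by simpa [Function.comp_def] using h.sum_lo
  sum_hi := Or.inl (by simpa [Function.comp_def] using hN)

lemma Bracket.raise_lo (h : Bracket f C N L) (hf : ∀ i, IsUtility C (f i))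
    (hp : IsPivot f C L p) (hN : (L.map (upTo f p)).sum < N) :
    Bracket f C N (L.map fun s => ⟨s.thread, upTo f p s, s.hi⟩) where
  le := by simpa using fun s hs => (h.upTo_mem hf hs).2
  le_cap := by simpa using h.le_cap
  hi_sep := by simpa using h.hi_sep
  lo_sep := by
    simp only [List.forall_mem_map]
    intro s hs t ht k k' hk hk' hC
    have h1 := (h.upTo_mem hf hs (p := p)).2.trans (h.le_cap s hs)
    exact (not_le.1 fun hh => hk'.not_gt ((h.lt_upTo_iff hf hp ht hC).2 hh)).trans_le
      ((h.lt_upTo_iff hf hp hs (hk.trans_le h1)).1 hk)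
  sum_lo := by simpa [Function.comp_def] using hN.le
  sum_hi := by simpa [Function.comp_def] using h.sum_hi

end Pivot

/-- The multiplier `price` proves that the allocation `out` is optimal. -/
structure IsPrice (f : Fin n → ℝ → ℝ) (C N : ℕ) (out : List (Share n)) (price : ℝ) : Prop where
  nonneg : 0 ≤ price
  le_cap : ∀ s ∈ out, s.amount ≤ C
  le_gain : ∀ s ∈ out, ∀ k < s.amount, price ≤ gain (f s.thread) k
  gain_le : ∀ s ∈ out, ∀ k, s.amount ≤ k → k < C → gain (f s.thread) k ≤ price
  sum_le : (out.map Share.amount).sum ≤ N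
  sum_eq : (out.map Share.amount).sum = N ∨ price = 0

/-- For points the lower and upper sums agree, which excludes `N` being below the upper sum. Hence
all amounts are `C`, and price `0` works because gains are nonnegative. -/
lemma isPrice_of_closed (hf : ∀ i, IsUtility C (f i)) {closed : List (Share n)}
    (h : Bracket f C N (closed.map Share.toPoint)) : IsPrice f C N closed 0 where
  nonneg := le_rfl
  le_cap := by simpa [Share.toPoint] using h.le_cap
  le_gain s hs k hk := (hf _).gain_nonneg
    (hk.trans_le (h.le_cap s.toPoint (List.mem_map_of_mem hs)))
  gain_le s hs k hk hkC := by
    rcases h.sum_hi with hN | hC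
    · refine absurd hN (not_lt.2 ((le_of_eq ?_).trans h.sum_lo))
      simp [Share.toPoint, Function.comp_def]
    · have := hC s.toPoint (List.mem_map_of_mem hs)
      simp only [Share.toPoint] at this
      omega
  sum_le := by simpa [Share.toPoint, Function.comp_def] using h.sum_lo
  sum_eq := Or.inr rfl

/-- The total number of bits of the lengths of the intervals. -/
def bits (L : List (Interval n)) : ℕ := (L.map fun s => (s.hi - s.lo).size).sum

lemma sum_add_countP_le {α : Type} {l : List α} {u v : α → ℕ} {P : α → Bool}
    (h : ∀ s ∈ l, u s + (if P s then 1 else 0) ≤ v s) :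
    (l.map u).sum + l.countP P ≤ (l.map v).sum := by
  induction l with
  | nil => simp
  | cons a l ih =>
    have h1 := ih fun s hs => h s (by simp [hs])
    have h2 := h a (by simp)
    simp only [List.map_cons, List.sum_cons, List.countP_cons]
    omega

/-- Finished threads have width `0` and hence no bits, so the potential can be compared across a
permutation that mixes open and finished intervals. -/
lemma bits_append_points (L : List (Interval n)) (closed : List (Share n)) :
    bits (L ++ closed.map Share.toPoint) = bits L := by
  simp [bits, Share.toPoint, Function.comp_def]

/-- An open interval has positive width, hence at least one bit. This pays for the final round,
after which no potential needs to remain. -/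
lemma length_le_bits {L : List (Interval n)} (h : ∀ s ∈ L, s.lo < s.hi) : L.length ≤ bits L := by
  induction L with
  | nil => simp
  | cons s L ih =>
    have h1 := ih fun t ht => h t (by simp [ht])
    have h2 : 0 < (s.hi - s.lo).size := Nat.size_pos.2 (by have := h s (by simp); omega)
    simp only [bits, List.map_cons, List.sum_cons, List.length_cons] at *
    omega

/-- What a run of `galilAux` achieves. -/
structure GalilSpec (f : Fin n → ℝ → ℝ) (C N : ℕ) (segs : List (Interval n))
    (closed : List (Share n)) (out : Timed (List (Share n))) : Prop where
  price : ∃ price, IsPrice f C N out.ret price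
  threads : (out.ret.map Share.thread).Perm (segs.map Interval.thread ++ closed.map Share.thread)
  time : out.time ≤ (2200 + 40 * C.size) * bits segs + 1

/-- Every unit handed out has gain at least `p` and every unit withheld has gain at most `p`; ties
at `p` may go either way. -/
lemma Bracket.isPrice {L : List (Interval n)} {p : ℝ} (h : Bracket f C N L)
    (hf : ∀ i, IsUtility C (f i)) (hp : IsPivot f C L p) {out : List (Share n)}
    (hout : ∀ x ∈ out, ∃ s ∈ L, x.thread = s.thread ∧ above f p s ≤ x.amount ∧
      x.amount ≤ upTo f p s) (hN : (out.map Share.amount).sum = N) : IsPrice f C N out p where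
  nonneg := by
    obtain ⟨s, -, k, -, hk, hg⟩ := hp.ge
    exact ((hf _).gain_nonneg hk).trans hg
  le_cap x hx := by
    obtain ⟨s, hs, -, -, hxs⟩ := hout x hx
    exact hxs.trans ((h.upTo_mem hf hs).2.trans (h.le_cap s hs))
  le_gain x hx k hk := by
    obtain ⟨s, hs, e, -, hxs⟩ := hout x hx
    have := (h.upTo_mem hf hs (p := p)).2.trans (h.le_cap s hs)
    rw [e]
    exact (h.lt_upTo_iff hf hp hs (by omega)).1 (by omega)
  gain_le x hx k hk hkC := by
    obtain ⟨s, hs, e, hxs, -⟩ := hout x hx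
    rw [e, ← not_lt, ← h.lt_above_iff hf hp hs hkC]
    omega
  sum_le := hN.le
  sum_eq := Or.inl hN

/-- The median of the marginal utilities at the midpoints is a pivot, and it halves at least half
of the intervals. -/
lemma median_spec {segs : List (Interval n)} (hne : segs ≠ []) (hopen : ∀ s ∈ segs, s.lo < s.hi)
    (hcap : ∀ s ∈ segs, s.hi ≤ C) {p : ℝ}
    (hr : HasRank (segs.length / 2)
      (segs.map fun s => gain (f s.thread) ((s.lo + s.hi) / 2)) p) :
    IsPivot f C segs p ∧
    segs.length ≤ 2 * segs.countP
      (fun s => decide (gain (f s.thread) ((s.lo + s.hi) / 2) ≤ p)) ∧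
    segs.length ≤ 2 * segs.countP
      (fun s => decide (p ≤ gain (f s.thread) ((s.lo + s.hi) / 2))) := by
  have hlen : 0 < segs.length := List.length_pos_iff.2 hne
  refine ⟨⟨?_, ?_⟩, ?_, ?_⟩
  · obtain ⟨a, ha, hle⟩ := hr.exists_le
    obtain ⟨s, hs, rfl⟩ := List.mem_map.1 ha
    have h1 := hopen s hs
    have h2 := hcap s hs
    exact ⟨s, hs, _, by omega, by omega, hle⟩
  · obtain ⟨a, ha, hle⟩ := hr.exists_ge (by simp; omega)
    obtain ⟨s, hs, rfl⟩ := List.mem_map.1 ha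
    have h1 := hopen s hs
    have h2 := hcap s hs
    exact ⟨s, hs, _, by omega, by omega, hle⟩
  · have h1 := hr.1
    have h2 := countP_lt_add_countP_le p
      (segs.map fun s => gain (f s.thread) ((s.lo + s.hi) / 2))
    simp only [List.countP_map, List.length_map, Function.comp_def] at h1 h2
    omega
  · have h1 := hr.2
    simp only [List.countP_map, Function.comp_def] at h1
    omega

lemma IsPivot.mono {L L' : List (Interval n)} {p : ℝ} (h : IsPivot f C L p) (hL : L ⊆ L') :
    IsPivot f C L' p :=
  ⟨h.le.imp fun _ hs => ⟨hL hs.1, hs.2⟩, h.ge.imp fun _ hs => ⟨hL hs.1, hs.2⟩⟩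

/-- One round with new intervals, followed by a successful recursive call. -/
lemma galil_round {segs : List (Interval n)} {closed : List (Share n)} {total : ℕ}
    {loc : Interval n → Located n} (hloc : ∀ s, (loc s).seg = s) {new : Located n → Interval n}
    (hthread : ∀ z, (new z).thread = z.seg.thread)
    (hB : Bracket f C N ((segs ++ closed.map Share.toPoint).map fun s => new (loc s)))
    (hpoint : ∀ s ∈ closed, new (loc s.toPoint) = s.toPoint)
    (ht : total = (closed.map Share.amount).sum) {P : Interval n → Bool}
    (hP : ∀ s ∈ segs, ((new (loc s)).hi - (new (loc s)).lo).size + (if P s then 1 else 0) ≤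
      (s.hi - s.lo).size) (hcount : segs.length ≤ 2 * segs.countP P) :
    let u := refine new (segs.map loc) closed total
    Bracket f C N (u.ret.1 ++ u.ret.2.1.map Share.toPoint) ∧ (∀ s ∈ u.ret.1, s.lo < s.hi) ∧
    u.ret.2.2 = (u.ret.2.1.map Share.amount).sum ∧ u.time ≤ 3 * segs.length + 1 ∧
    segs.length + 2 * bits u.ret.1 ≤ 2 * bits segs ∧
    (u.ret.1.map Interval.thread ++ u.ret.2.1.map Share.thread).Perm
      (segs.map Interval.thread ++ closed.map Share.thread) := by
  intro u
  obtain ⟨h1, h2, h3, h4⟩ := refine_spec new (segs.map loc) closed total (by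
    simp only [List.forall_mem_map]
    refine fun s hs => ⟨hthread _, hB.le _ (List.mem_map_of_mem (by simp [hs]))⟩) ht
  have e : closed.map Share.toPoint = (closed.map Share.toPoint).map fun s => new (loc s) := by
    simp only [List.map_map]
    exact List.map_congr_left fun s hs => (hpoint s hs).symm
  rw [List.map_map] at h1
  refine ⟨hB.perm (h1.trans (.of_eq ?_)), h2, h3, by simpa using h4, ?_, ?_⟩
  · rw [List.map_append, ← e]; rfl
  · have hb : bits u.ret.1 = bits (segs.map (new ∘ loc)) := by
      rw [← bits_append_points _ u.ret.2.1, ← bits_append_points (segs.map _) closed]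
      exact (h1.map _).sum_eq
    have := sum_add_countP_le hP
    rw [hb]
    simp only [bits, List.map_map, Function.comp_def] at this ⊢
    omega
  · have := h1.map Interval.thread
    simpa [Function.comp_def, Share.toPoint, hthread, hloc] using this

lemma galilSpec_iff {segs : List (Interval n)} {closed : List (Share n)}
    {out : Timed (List (Share n))} : GalilSpec f C N segs closed out ↔
    (∃ price, IsPrice f C N out.ret price) ∧
    (out.ret.map Share.thread).Perm (segs.map Interval.thread ++ closed.map Share.thread) ∧
    out.time ≤ (2200 + 40 * C.size) * bits segs + 1 :=
  ⟨fun h => ⟨h.1, h.2, h.3⟩, fun h => ⟨h.1, h.2.1, h.2.2⟩⟩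

/-- The induction pays for each round out of the drop in `bits`. A round costs at most `(1100 + 20 *
C.size) * segs.length` steps and lowers `bits` by at least `segs.length / 2`, whence the doubled
constant in the bound. -/
lemma galilAux_spec (hf : ∀ i, IsUtility C (f i)) (fuel : ℕ) (segs : List (Interval n))
    (closed : List (Share n)) (total : ℕ)
    (hB : Bracket f C N (segs ++ closed.map Share.toPoint)) (hopen : ∀ s ∈ segs, s.lo < s.hi)
    (ht : total = (closed.map Share.amount).sum) (hfuel : bits segs < fuel) :
    GalilSpec f C N segs closed (galilAux f N fuel segs closed total) := by
  induction fuel generalizing segs closed total with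
  | zero => omega
  | succ fuel ih =>
    rcases segs with _ | ⟨s₀, l₀⟩
    · exact ⟨⟨0, isPrice_of_closed hf hB⟩, by simp [galilAux], by simp [galilAux]⟩
    rw [galilAux]
    have hne : s₀ :: l₀ ≠ [] := by simp
    generalize s₀ :: l₀ = segs at *
    clear s₀ l₀
    have hlen : 0 < segs.length := List.length_pos_iff.2 hne
    have hbits := length_le_bits hopen
    have hr := select_hasRank (k := segs.length / 2)
      (l := segs.map fun s => gain (f s.thread) ((s.lo + s.hi) / 2)) (by simp; omega)
    have tsel := select_time_le (segs.length / 2)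
      (segs.map fun s => gain (f s.thread) ((s.lo + s.hi) / 2))
    rw [List.length_map] at tsel
    have tmid := time_midpoints f segs
    rw [galilSpec_iff]
    simp only [ret_midpoints, ret_length, ret_step, ret_locate, ret_bind, List.length_map,
      time_bind, time_length, time_step, time_tick]
    generalize (select (segs.length / 2)
      (segs.map fun s => gain (f s.thread) ((s.lo + s.hi) / 2))).ret = p at *
    obtain ⟨hp₀, hc1, hc2⟩ := median_spec hne hopen
      (fun s hs => hB.le_cap s (by simp [hs])) hr
    have hp := hp₀.mono (List.subset_append_left segs (closed.map Share.toPoint))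
    have tloc := time_locate_le f p segs (b := C.size) fun s hs => Nat.size_le_size <|
      (Nat.sub_le _ _).trans (hB.le_cap s (by simp [hs]))
    -- A finished thread is an interval of one point, so no pivot moves it. The pivot counts over
    -- all threads are thus `total` plus those over the open ones.
    have hpt1 : ∀ s ∈ closed, above f p s.toPoint = s.amount := fun s hs => by
      have := hB.above_mem hf (p := p) (s := s.toPoint) (by simp; exact Or.inr ⟨s, hs, rfl⟩)
      exact le_antisymm this.2 this.1
    have hpt2 : ∀ s ∈ closed, upTo f p s.toPoint = s.amount := fun s hs => by
      have := hB.upTo_mem hf (p := p) (s := s.toPoint) (by simp; exact Or.inr ⟨s, hs, rfl⟩)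
      exact le_antisymm this.2 this.1
    have hsum1 : ((segs ++ closed.map Share.toPoint).map (above f p)).sum =
        total + (segs.map (above f p)).sum := by
      rw [List.map_append, List.sum_append, add_comm, ht, List.map_map,
        List.map_congr_left (f := above f p ∘ Share.toPoint) (g := Share.amount) hpt1]
    have hsum2 : ((segs ++ closed.map Share.toPoint).map (upTo f p)).sum =
        total + (segs.map (upTo f p)).sum := by
      rw [List.map_append, List.sum_append, add_comm, ht, List.map_map,
        List.map_congr_left (f := upTo f p ∘ Share.toPoint) (g := Share.amount) hpt2]
    have tround : (1100 + 20 * C.size) * segs.length * 2 =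
        2 * ((20 * C.size + 7) * segs.length) + 2186 * segs.length := by ring
    have tmul : (2200 + 40 * C.size) * segs.length = (1100 + 20 * C.size) * segs.length * 2 := by
      ring
    by_cases h1 : N < total + (segs.map (above f p)).sum
    · simp only [h1, decide_true, if_true, ret_bind, time_bind]
      obtain ⟨r1, r2, r3, r4, r5, r6⟩ := galil_round (closed := closed) (total := total)
        (loc := fun s => ⟨s, above f p s, upTo f p s⟩) (fun _ => rfl)
        (new := fun z => ⟨z.seg.thread, z.seg.lo, z.gt⟩) (fun _ => rfl)
        (hB.lower_hi hf hp (hsum1 ▸ h1)) (fun s hs => by simp only [hpt1 s hs]; rfl) ht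
        (P := fun s => decide (gain (f s.thread) ((s.lo + s.hi) / 2) ≤ p)) (fun s hs => by
          have hm := hB.above_mem hf (p := p) (s := s) (by simp [hs])
          have ho := hopen s hs
          simp only [decide_eq_true_eq]
          split_ifs with hle
          · have hC := hB.le_cap s (by simp [hs])
            -- A midpoint not above the pivot is not counted, so the new upper end is at most the
            -- midpoint.
            have : ¬(s.lo + s.hi) / 2 < above f p s := by
              rw [hB.lt_above_iff hf hp (by simp [hs]) (by omega)]
              exact hle.not_gt
            exact size_succ_le_of_le_half (by omega) (by omega)
          · exact Nat.size_le_size (by omega)) hc1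
      obtain ⟨g1, g2, g3⟩ := ih _ _ _ r1 r2 r3 (by omega)
      refine ⟨g1, g2.trans r6, ?_⟩
      have := Nat.mul_le_mul_left (1100 + 20 * C.size) r5
      nlinarith
    by_cases h2 : total + (segs.map (upTo f p)).sum < N
    · simp only [h1, h2, decide_true, decide_false, if_true, if_false, ret_bind, time_bind, ret_step,
        time_step, Bool.false_eq_true]
      obtain ⟨r1, r2, r3, r4, r5, r6⟩ := galil_round (closed := closed) (total := total)
        (loc := fun s => ⟨s, above f p s, upTo f p s⟩) (fun _ => rfl)
        (new := fun z => ⟨z.seg.thread, z.ge, z.seg.hi⟩) (fun _ => rfl)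
        (hB.raise_lo hf hp (hsum2 ▸ h2)) (fun s hs => by simp only [hpt2 s hs]; rfl) ht
        (P := fun s => decide (p ≤ gain (f s.thread) ((s.lo + s.hi) / 2))) (fun s hs => by
          have hm := hB.upTo_mem hf (p := p) (s := s) (by simp [hs])
          have ho := hopen s hs
          simp only [decide_eq_true_eq]
          split_ifs with hle
          · have hC := hB.le_cap s (by simp [hs])
            -- A midpoint not below the pivot is counted, so the new lower end lies strictly beyond
            -- the midpoint.
            have : (s.lo + s.hi) / 2 < upTo f p s := by
              rw [hB.lt_upTo_iff hf hp (by simp [hs]) (by omega)]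
              exact hle
            exact size_succ_le_of_le_half (by omega) (by omega)
          · exact Nat.size_le_size (by omega)) hc2
      obtain ⟨g1, g2, g3⟩ := ih _ _ _ r1 r2 r3 (by omega)
      refine ⟨g1, g2.trans r6, ?_⟩
      have := Nat.mul_le_mul_left (1100 + 20 * C.size) r5
      nlinarith
    · simp only [h1, h2, decide_false, if_false, ret_bind, time_bind, ret_step, time_step,
        Bool.false_eq_true, time_share, List.length_map]
      have hle : ∀ s ∈ segs, above f p s ≤ upTo f p s := fun s hs =>
        hB.above_le_upTo hf hp (by simp [hs])
      have eg : ((segs.map fun s => (⟨s, above f p s, upTo f p s⟩ : Located n)).map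
          Located.gt).sum = (segs.map (above f p)).sum := by rw [List.map_map]; rfl
      have ee : ((segs.map fun s => (⟨s, above f p s, upTo f p s⟩ : Located n)).map
          Located.ge).sum = (segs.map (upTo f p)).sum := by rw [List.map_map]; rfl
      obtain ⟨l', s1, s2, s3, s4⟩ := share_spec
        (segs.map fun s => (⟨s, above f p s, upTo f p s⟩ : Located n))
        (N - (total + (segs.map (above f p)).sum)) closed (by simpa using hle) (by
          rw [eg, ee]
          omega)
      refine ⟨⟨p, hB.isPrice hf hp ?_ ?_⟩, ?_, ?_⟩
      · intro x hx
        rcases List.mem_append.1 (s1.mem_iff.1 hx) with hx | hx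
        · obtain ⟨z, hz, hxz⟩ := s3 x hx
          obtain ⟨s, hs, rfl⟩ := List.mem_map.1 hz
          exact ⟨s, by simp [hs], hxz⟩
        · exact ⟨x.toPoint, by simp; exact Or.inr ⟨x, hx, rfl⟩, rfl, (hpt1 x hx).le, (hpt2 x hx).ge⟩
      · rw [(s1.map _).sum_eq, List.map_append, List.sum_append, s4, eg, ← ht]
        omega
      · have := s1.map Share.thread
        simpa [s2, Function.comp_def] using this
      · nlinarith

/-- The allocation that Galil's algorithm finds, and the time that it takes. -/
lemma galil_spec {m : ℕ} (hC : 0 < C) (hf : ∀ i, IsUtility C (f i)) :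
    (∃ price, IsPrice f C (m * C) (galil m C f).ret price) ∧
    ((galil m C f).ret.map Share.thread).Perm (List.finRange n) ∧
    (galil m C f).time ≤ (2200 + 40 * C.size) * (n * C.size) + n + 3 := by
  have hb : bits ((List.finRange n).map fun i => (⟨i, 0, C⟩ : Interval n)) = n * C.size := by
    simp [bits, Function.comp_def]
  -- This makes the fuel `n * C + 1` exceed the initial potential `n * C.size`.
  have hs : C.size ≤ C := Nat.size_le.2 Nat.lt_two_pow_self
  obtain ⟨h1, h2, h3⟩ := galilAux_spec (N := m * C) hf (n * C + 1)
    ((List.finRange n).map fun i => (⟨i, 0, C⟩ : Interval n)) [] 0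
    { le := by simp
      le_cap := by simp
      lo_sep := by simp
      hi_sep := by
        simp only [List.map_nil, List.append_nil, List.forall_mem_map]
        intros; omega
      sum_lo := by simp [Function.comp_def]
      -- At the start the second alternative is the one that always holds: `n * C` need not exceed
      -- `m * C`.
      sum_hi := Or.inr (by simp) } (by simp [hC]) (by simp)
    (by rw [hb]; exact Nat.lt_succ_of_le (Nat.mul_le_mul_left _ hs))
  simp only [galil, ret_bind, time_bind, ret_step, time_step, ret_initial, time_initial]
  refine ⟨h1, by simpa [Function.comp_def] using h2, ?_⟩
  rw [hb] at h3
  simp only [List.length_finRange]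
  omega

end Galil

/-! ### Optimality -/

section Optimal

variable {n m C : ℕ} {f : Fin n → ℝ → ℝ}

/-- The increments of `y ↦ g y - price * y` are nonnegative up to `a` and nonpositive from `a` on.
-/
lemma gain_sum_le {g : ℝ → ℝ} {price : ℝ} {a C : ℕ} (ha : a ≤ C)
    (h1 : ∀ k < a, price ≤ gain g k) (h2 : ∀ k, a ≤ k → k < C → gain g k ≤ price) {y : ℕ}
    (hy : y ≤ C) : g y - price * y ≤ g a - price * a := by
  rcases le_total a y with h | h
  · induction y, h using Nat.le_induction with
    | base => exact le_rfl
    | succ y hay ih =>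
      have e1 := ih (by omega)
      have e2 := h2 y hay (by omega)
      simp only [gain] at e2
      push_cast at *
      linarith
  · induction h using Nat.decreasingInduction with
    | self => exact le_rfl
    | of_succ y hya ih =>
      have e1 := ih (by omega)
      have e2 := h1 y hya
      simp only [gain] at e2
      push_cast at *
      linarith

/-- An allocation, supported by a price, maximizes the utility minus the price. -/
structure Supported (f : Fin n → ℝ → ℝ) (m C : ℕ) (chat : Fin n → ℕ) (price : ℝ) : Prop where
  nonneg : 0 ≤ price
  le_cap : ∀ i, chat i ≤ C
  max : ∀ i, ∀ y : ℕ, y ≤ C → f i y - price * y ≤ f i (chat i) - price * chat i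
  sum_le : ∑ i, chat i ≤ m * C
  sum_eq : ∑ i, chat i = m * C ∨ price = 0

/-- Weak duality: summing the price inequalities bounds the utility lost from below by the price
times the unused budget of `y`, and complementary slackness is `sum_eq`. Keeping `hmax` as a
hypothesis lets integer and real allocations share the argument. -/
lemma Supported.isSuperOptimal {chat : Fin n → ℕ} {price : ℝ} (h : Supported f m C chat price)
    {S : Set ℝ} (hS : ∀ i, (chat i : ℝ) ∈ S)
    (hmax : ∀ i, ∀ y ∈ Set.Icc (0 : ℝ) C ∩ S,
      f i y - price * y ≤ f i (chat i) - price * chat i) :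
    IsSuperOptimal S m C f (fun i => (chat i : ℝ)) where
  mem i := ⟨natCast_mem_Icc (h.le_cap i), hS i⟩
  budget := by exact_mod_cast h.sum_le
  optimal y hy hsum := by
    have h1 : ∑ i, (f i (y i) - price * y i) ≤ ∑ i, (f i (chat i) - price * chat i) :=
      Finset.sum_le_sum fun i _ => hmax i _ (hy i)
    rw [Finset.sum_sub_distrib, Finset.sum_sub_distrib, ← Finset.mul_sum, ← Finset.mul_sum] at h1
    have h2 : price * ∑ i, y i ≤ price * ∑ i, (chat i : ℝ) := by
      rcases h.sum_eq with he | he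
      · refine mul_le_mul_of_nonneg_left (hsum.trans_eq ?_) h.nonneg
        exact_mod_cast he.symm
      · simp [he]
    linarith

lemma Supported.isSuperOptimal_units {chat : Fin n → ℕ} {price : ℝ}
    (h : Supported f m C chat price) :
    IsSuperOptimal (Set.range (Nat.cast : ℕ → ℝ)) m C f (fun i => (chat i : ℝ)) :=
  h.isSuperOptimal (fun i => ⟨_, rfl⟩) (by
    rintro i _ ⟨hy, y, rfl⟩
    exact h.max i y (by exact_mod_cast hy.2))

lemma Supported.isSuperOptimal_univ {chat : Fin n → ℕ} {price : ℝ}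
    (h : Supported f m C chat price) (haff : ∀ i, AffineOnUnits C (f i)) :
    IsSuperOptimal Set.univ m C f (fun i => (chat i : ℝ)) :=
  h.isSuperOptimal (fun i => trivial) (by
    rintro i y ⟨hy, -⟩
    -- The endpoint `y = C` is separate because no unit interval inside `[0, C]` starts there.
    -- Elsewhere the inequality at `y` is a convex combination of those at `⌊y⌋₊` and `⌊y⌋₊ + 1`.
    rcases hy.2.eq_or_lt with rfl | hlt
    · exact h.max i C le_rfl
    have hfl : ⌊y⌋₊ < C := (Nat.floor_lt hy.1).2 hlt
    have ht0 : 0 ≤ y - ⌊y⌋₊ := sub_nonneg.2 (Nat.floor_le hy.1)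
    have ht1 : y - ⌊y⌋₊ ≤ 1 := by linarith [Nat.lt_floor_add_one y]
    have e := haff i ⌊y⌋₊ hfl (y - ⌊y⌋₊) ⟨ht0, ht1⟩
    rw [add_sub_cancel] at e
    have h1 := mul_le_mul_of_nonneg_left (h.max i ⌊y⌋₊ hfl.le) (sub_nonneg.2 ht1)
    have h2 := mul_le_mul_of_nonneg_left (h.max i (⌊y⌋₊ + 1) hfl) ht0
    push_cast at h2
    rw [e]
    linarith)

/-- Each thread occurs exactly once in the list, so a list of records can be read as a function on
threads. -/
lemma exists_fun_of_perm_finRange {α : Type} (thread : α → Fin n) {l : List α}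
    (h : (l.map thread).Perm (List.finRange n)) :
    ∃ pick : Fin n → α, ∀ x ∈ l, pick (thread x) = x := by
  have hex : ∀ i, ∃ x ∈ l, thread x = i := fun i => by
    simpa using h.mem_iff.2 (List.mem_finRange i)
  choose pick h1 h2 using hex
  have hnd : (l.map thread).Nodup := h.nodup_iff.2 (List.nodup_finRange n)
  exact ⟨pick, fun x hx => List.inj_on_of_nodup_map hnd (h1 _) hx (h2 _)⟩

lemma IsPrice.supported {shares : List (Share n)} {price : ℝ}
    (h : IsPrice f C (m * C) shares price)
    (hp : (shares.map Share.thread).Perm (List.finRange n)) {chat : Fin n → ℕ}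
    (hchat : ∀ s ∈ shares, chat s.thread = s.amount) : Supported f m C chat price := by
  have hex : ∀ i, ∃ s ∈ shares, s.thread = i := fun i => by
    simpa using hp.mem_iff.2 (List.mem_finRange i)
  have hsum : ∑ i, chat i = (shares.map Share.amount).sum := by
    rw [Fin.sum_univ_def, ← (hp.map chat).sum_eq, List.map_map]
    exact congrArg _ (List.map_congr_left hchat)
  refine ⟨h.nonneg, fun i => ?_, fun i y hy => ?_, hsum ▸ h.sum_le, hsum ▸ h.sum_eq⟩
  · obtain ⟨s, hs, rfl⟩ := hex i
    exact hchat s hs ▸ h.le_cap s hs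
  · obtain ⟨s, hs, rfl⟩ := hex i
    rw [hchat s hs]
    exact gain_sum_le (h.le_cap s hs) (h.le_gain s hs) (h.gain_le s hs) hy

end Optimal

/-! ### The heap -/

namespace Heap

/-- The pairs stored in the heap. -/
def toList : Heap → List (ℕ × ℕ)
  | .leaf => []
  | .node R j l r => (R, j) :: (l.toList ++ r.toList)

/-- No node is greater than its parent. -/
def Valid : Heap → Prop
  | .leaf => True
  | .node R _ l r => l.rootLe R ∧ r.rootLe R ∧ l.Valid ∧ r.Valid

def depth : Heap → ℕ
  | .leaf => 0
  | .node _ _ l r => max l.depth r.depth + 1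

lemma rootLe_trans {H : Heap} {R R' : ℕ} (h : H.rootLe R) (hR : R ≤ R') : H.rootLe R' := by
  cases H <;> simp_all [rootLe]
  omega

lemma Valid.le {H : Heap} (h : H.Valid) {R : ℕ} (hR : H.rootLe R) :
    ∀ x ∈ H.toList, x.1 ≤ R := by
  induction H generalizing R with
  | leaf => simp [toList]
  | node R' j l r ihl ihr =>
    obtain ⟨hl, hr, vl, vr⟩ := h
    have hR' : R' ≤ R := by simpa [rootLe] using hR
    simp only [toList, List.mem_cons, List.mem_append]
    rintro x (rfl | hx | hx)
    · exact hR'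
    · exact (ihl vl hl x hx).trans hR'
    · exact (ihr vr hr x hx).trans hR'

lemma build_of_pos (C j : ℕ) {k : ℕ} (hk : 0 < k) :
    (build C j k).ret = .node C j (build C (j + 1) ((k - 1) / 2)).ret
      (build C (j + 1 + (k - 1) / 2) (k - 1 - (k - 1) / 2)).ret ∧
    (build C j k).time = 6 + (build C (j + 1) ((k - 1) / 2)).time +
      (build C (j + 1 + (k - 1) / 2) (k - 1 - (k - 1) / 2)).time := by
  rw [build]
  simp [hk.ne']
  omega

lemma build_zero (C j : ℕ) : (build C j 0).ret = .leaf ∧ (build C j 0).time = 1 := by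
  rw [build]
  simp

lemma build_spec (C j k : ℕ) :
    (build C j k).ret.Valid ∧ (build C j k).ret.rootLe C ∧
    (build C j k).ret.toList = (List.range' j k).map (fun i => (C, i)) ∧
    (build C j k).ret.depth ≤ k.size ∧ (build C j k).time ≤ 7 * k + 1 := by
  induction k using Nat.strong_induction_on generalizing j with
  | _ k ih =>
    rcases Nat.eq_zero_or_pos k with rfl | hk
    · simp [build_zero, Valid, rootLe, toList, depth]
    · obtain ⟨e, et⟩ := build_of_pos C j hk
      rw [e, et]
      obtain ⟨v1, r1, l1, d1, t1⟩ := ih ((k - 1) / 2) (by omega) (j + 1)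
      obtain ⟨v2, r2, l2, d2, t2⟩ := ih (k - 1 - (k - 1) / 2) (by omega) (j + 1 + (k - 1) / 2)
      refine ⟨⟨r1, r2, v1, v2⟩, by simp [rootLe], ?_, ?_, by omega⟩
      · rw [toList, l1, l2, ← List.map_append, ← List.map_cons (f := fun i => (C, i))]
        congr 1
        obtain ⟨k, rfl⟩ := Nat.exists_eq_succ_of_ne_zero hk.ne'
        rw [List.range'_succ, List.range'_append_1]
        congr 2
        omega
      · have s1 := size_succ_le_of_le_half hk (show (k - 1) / 2 ≤ k / 2 by omega)
        have s2 := size_succ_le_of_le_half hk (show k - 1 - (k - 1) / 2 ≤ k / 2 by omega)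
        simp only [depth]
        omega

/-- The depth is preserved, so the logarithmic bound survives all iterations. The clause about `B`
restores the heap order at the parent after the recursive call; the last clause says that just the
old root entry is exchanged. Each level costs one call and at most three comparisons. -/
lemma replaceRoot_spec (R j : ℕ) (H : Heap) (h : H.Valid) :
    (replaceRoot R j H).ret.depth = H.depth ∧
    (replaceRoot R j H).time ≤ 4 * H.depth + 1 ∧
    (replaceRoot R j H).ret.Valid ∧
    (∀ B, R ≤ B → H.rootLe B → (replaceRoot R j H).ret.rootLe B) ∧
    ∀ R₀ j₀ l r, H = .node R₀ j₀ l r →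
      (replaceRoot R j H).ret.toList.Perm ((R, j) :: (l.toList ++ r.toList)) := by
  induction H with
  | leaf => simp [replaceRoot, Valid, rootLe, depth]
  | node R₀ j₀ l r ihl ihr =>
    obtain ⟨hl, hr, vl, vr⟩ := h
    obtain ⟨dl, tl, wl, bl, pl⟩ := ihl vl
    obtain ⟨dr, tr, wr, br, pr⟩ := ihr vr
    by_cases h1 : l.rootLe R = true ∧ r.rootLe R = true
    · simp only [replaceRoot, ret_bind, time_bind, ret_step, time_step, time_tick, h1.1, h1.2,
        Bool.and_self, if_true, ret_pure, time_pure]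
      refine ⟨rfl, by simp only [depth]; omega, ⟨h1.1, h1.2, vl, vr⟩, ?_, ?_⟩
      · intro B hB _
        simpa [rootLe] using hB
      · rintro _ _ _ _ ⟨⟩
        rfl
    have h1' : (l.rootLe R && r.rootLe R) = false := by
      rw [← Bool.not_eq_true, Bool.and_eq_true]; exact h1
    by_cases h2 : r.rootLe l.rootLeft = true
    · simp only [replaceRoot, ret_bind, time_bind, ret_step, time_step, time_tick, h1', h2,
        Bool.false_eq_true, if_false, if_true, ret_pure, time_pure]
      cases l with
      | leaf =>
        -- A missing left child counts as `0`; then the right child is at most `0 ≤ R` and no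
        -- sifting would be needed.
        refine absurd ⟨rfl, rootLe_trans h2 (Nat.zero_le R)⟩ h1
      | node R₁ j₁ l₁ r₁ =>
        -- Otherwise the larger child would be below `R`, and so would both children, against `h1`.
        have hR : R ≤ R₁ := by
          by_contra hc
          exact h1 ⟨by simp [rootLe]; omega, rootLe_trans h2 (by simp [rootLeft]; omega)⟩
        simp only [rootLeft, rootServer] at *
        refine ⟨by simp only [depth] at *; omega, by simp only [depth] at *; omega,
          ⟨bl R₁ hR (by simp [rootLe]), h2, wl, vr⟩, ?_, ?_⟩
        · intro B _ hB
          simp [rootLe] at hB hl ⊢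
          omega
        · rintro _ _ _ _ ⟨⟩
          simp only [toList]
          refine List.Perm.trans (((pl _ _ _ _ rfl).append_right _).cons _) ?_
          exact List.Perm.swap _ _ _
    · simp only [replaceRoot, ret_bind, time_bind, ret_step, time_step, time_tick, h1', h2,
        Bool.false_eq_true, if_false, ret_pure, time_pure]
      cases r with
      | leaf => simp [rootLe] at h2
      | node R₁ j₁ l₁ r₁ =>
        have h2' : l.rootLeft < R₁ := by simpa [rootLe] using h2
        have hlR : l.rootLe R₁ := by
          cases l <;> simp [rootLe, rootLeft] at h2' ⊢
          omega
        have hR : R ≤ R₁ := by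
          by_contra hc
          exact h1 ⟨rootLe_trans hlR (by omega), by simp [rootLe]; omega⟩
        simp only [rootLeft, rootServer] at *
        refine ⟨by simp only [depth] at *; omega, by simp only [depth] at *; omega,
          ⟨hlR, br R₁ hR (by simp [rootLe]), vl, wr⟩, ?_, ?_⟩
        · intro B _ hB
          simp [rootLe] at hB hr ⊢
          omega
        · rintro _ _ _ _ ⟨⟩
          simp only [toList]
          refine List.Perm.trans (((pr _ _ _ _ rfl).append_left _).cons _) ?_
          exact ((List.perm_middle.cons _).trans (List.Perm.swap _ _ _)).trans
            (List.perm_middle.symm.cons _)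

/-- The heap `H` stores the amounts `R`. -/
def Stores {m : ℕ} (H : Heap) (R : Fin m → ℕ) : Prop :=
  H.toList.Perm ((List.finRange m).map fun j => (R j, (j : ℕ)))

lemma stores_build (C m : ℕ) : (build C 0 m).ret.Stores fun _ : Fin m => C := by
  rw [Stores, (build_spec C 0 m).2.2.1, ← List.range_eq_range', ← List.map_coe_finRange_eq_range,
    List.map_map]
  rfl

/-- Each server occurs once, so removing the root entry leaves exactly the entries of the other
servers, which the update does not touch. -/
lemma Stores.update_root {m : ℕ} {R : Fin m → ℕ} {a j : ℕ} {l r : Heap}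
    (h : (node a j l r).Stores R) : ∃ i : Fin m, (i : ℕ) = j ∧ R i = a ∧
      ∀ a', ((a', j) :: (l.toList ++ r.toList)).Perm
        ((List.finRange m).map fun k => (Function.update R i a' k, (k : ℕ))) := by
  have hmem : (a, j) ∈ (List.finRange m).map fun j => (R j, (j : ℕ)) :=
    h.mem_iff.1 (by simp [toList])
  obtain ⟨i, -, hi⟩ := List.mem_map.1 hmem
  obtain ⟨rfl, rfl⟩ := Prod.mk.inj hi
  refine ⟨i, rfl, rfl, fun a' => ?_⟩
  have hp := List.perm_cons_erase (List.mem_finRange i)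
  have h1 := (h.trans (hp.map _)).cons_inv
  refine List.Perm.trans ?_ (hp.map _).symm
  simp only [List.map_cons, Function.update_self]
  refine (h1.trans (.of_eq (List.map_congr_left fun k hk => ?_))).cons _
  have hne : k ≠ i := ((List.nodup_finRange m).mem_erase_iff.1 hk).1
  rw [Function.update_of_ne hne]

end Heap

/-! ### The main loop -/

/-- The histories `Rs` and `js` of remaining amounts and chosen servers are built along the
recursion. Depth is invariant, so every iteration is charged the initial depth. -/
lemma assign_spec {n m : ℕ} (hm : 0 < m) (l : List (Job n)) (H : Heap) (hH : H.Valid)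
    (R : Fin m → ℕ) (hR : H.Stores R) :
    (∃ (Rs : ℕ → Fin m → ℕ) (js : ℕ → Fin m), Rs 0 = R ∧
      (assign l H).ret.length = l.length ∧ ∀ k x, l[k]? = some x →
        (∀ j, Rs k j ≤ Rs k (js k)) ∧
        (assign l H).ret[k]? = some ⟨x.thread, x.chat, js k, min x.chat (Rs k (js k))⟩ ∧
        Rs (k + 1) = Function.update (Rs k) (js k)
          (Rs k (js k) - min x.chat (Rs k (js k)))) ∧
    (assign l H).time ≤ (4 * H.depth + 4) * l.length + 1 := by
  induction l generalizing H R with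
  | nil => exact ⟨⟨fun _ => R, fun _ => ⟨0, hm⟩, rfl, by simp [assign], by simp⟩, by simp [assign]⟩
  | cons x l ih =>
    cases H with
    | leaf =>
      have := hR.length_eq
      simp [Heap.toList] at this
      omega
    | node a j hl hr =>
      obtain ⟨i, rfl, rfl, hu⟩ := hR.update_root
      have hmax : ∀ j', R j' ≤ R i := fun j' =>
        hH.le (R := R i) (by simp [Heap.rootLe]) (R j', j')
          (hR.mem_iff.2 (List.mem_map.2 ⟨j', List.mem_finRange _, rfl⟩))
      obtain ⟨hd, ht, hv, -, hp⟩ :=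
        Heap.replaceRoot_spec (R i - min x.chat (R i)) i _ hH
      obtain ⟨⟨Rs, js, h0, hlen, h⟩, htime⟩ := ih _ hv _ ((hp _ _ _ _ rfl).trans (hu _))
      simp only [assign, ret_bind, time_bind, ret_step, time_step, time_tick, ret_pure, time_pure]
      -- The histories of the recursive call are shifted by one, with the current state and server
      -- put in front.
      refine ⟨⟨fun k => Nat.casesOn k R Rs, fun k => Nat.casesOn k i js, rfl, by simp [hlen], ?_⟩,
        ?_⟩
      · rintro (_ | k) y hy
        · obtain rfl : x = y := by simpa using hy
          exact ⟨hmax, by simp, h0⟩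
        · obtain ⟨h1, h2, h3⟩ := h k y (by simpa using hy)
          exact ⟨h1, by simpa using h2, h3⟩
      · rw [hd] at htime
        rw [List.length_cons, mul_add, mul_one]
        omega

/-! ### Algorithm 2 -/

section Algorithm

variable {n m C : ℕ} {f : Fin n → ℝ → ℝ}

noncomputable section

/-- The record of thread `i` when its super-optimal amount is `chat i`. -/
def jobOf (f : Fin n → ℝ → ℝ) (chat : Fin n → ℕ) (i : Fin n) : Job n :=
  ⟨i, chat i, f i (chat i), f i (chat i) / chat i⟩

end

lemma ret_jobs {chat : Fin n → ℕ} {l : List (Share n)} (h : ∀ s ∈ l, chat s.thread = s.amount) :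
    (jobs f l).ret = (l.map Share.thread).map (jobOf f chat) := by
  induction l with
  | nil => rfl
  | cons s l ih =>
    have hs := h s (by simp)
    simp [jobs, ih fun t ht => h t (by simp [ht]), jobOf, hs, query]

lemma time_jobs (l : List (Share n)) : (jobs f l).time = 3 * l.length + 1 := by
  induction l with
  | nil => rfl
  | cons s l ih => simp [jobs, ih, query]; ring

lemma exists_perm_of_perm_finRange {l : List (Fin n)} (h : l.Perm (List.finRange n)) :
    ∃ τ : Equiv.Perm (Fin n), l = List.ofFn τ := by
  have hlen : l.length = n := by simpa using h.length_eq
  have hinj : Function.Injective fun k : Fin n => l[k.val]'(hlen.symm ▸ k.2) := fun a b hab =>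
    Fin.ext <| (h.nodup_iff.2 (List.nodup_finRange n)).getElem_inj_iff.1 hab
  exact ⟨Equiv.ofBijective _ (Finite.injective_iff_bijective.1 hinj),
    List.ext_getElem (by simp [hlen]) (by simp)⟩

/-- A job is determined by its thread, so reordering the jobs amounts to permuting the threads. -/
lemma exists_perm_of_jobs {chat : Fin n → ℕ} {l : List (Job n)}
    (h : l.Perm ((List.finRange n).map (jobOf f chat))) :
    ∃ τ : Equiv.Perm (Fin n), l = List.ofFn fun k => jobOf f chat (τ k) := by
  have h1 : (l.map Job.thread).Perm (List.finRange n) :=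
    (h.map _).trans (.of_eq (by simp [Function.comp_def, jobOf]))
  obtain ⟨τ, hτ⟩ := exists_perm_of_perm_finRange h1
  refine ⟨τ, ?_⟩
  have h2 : l = (l.map Job.thread).map (jobOf f chat) := by
    rw [List.map_map]
    conv_lhs => rw [← List.map_id l]
    refine List.map_congr_left fun x hx => ?_
    obtain ⟨i, -, rfl⟩ := List.mem_map.1 (h.mem_iff.1 hx)
    rfl
  rw [h2, hτ, List.map_ofFn]
  rfl

@[simp] lemma linearized_self (g : ℝ → ℝ) (a : ℝ) : linearized g a a = g a := by
  simp [linearized]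

/-- The threads in the order in which Algorithm 2 processes them. -/
lemma order_spec {chat : Fin n → ℕ} {js : List (Job n)}
    (hjs : js.Perm ((List.finRange n).map (jobOf f chat))) :
    let sorted := (mergeSort Job.value js).ret
    ∃ σ : Equiv.Perm (Fin n),
      sorted.take m ++ (mergeSort Job.slope (sorted.drop m)).ret =
        (List.ofFn fun k => jobOf f chat (σ k)) ∧
      (∃ τ : Equiv.Perm (Fin n),
        Antitone (fun k => linearized (f (τ k)) (chat (τ k)) (chat (τ k))) ∧
        ∀ k : Fin n, (k : ℕ) < m → σ k = τ k) ∧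
      ∀ k l : Fin n, m ≤ (k : ℕ) → k ≤ l →
        linearized (f (σ l)) (chat (σ l)) (chat (σ l)) / (chat (σ l) : ℝ) ≤
          linearized (f (σ k)) (chat (σ k)) (chat (σ k)) / (chat (σ k) : ℝ) := by
  intro sorted
  have hs : sorted.Perm js := mergeSort_perm _ _
  have hd : Decreasing Job.value sorted := mergeSort_decreasing _ _
  obtain ⟨τ, hτ⟩ := exists_perm_of_jobs (hs.trans hjs)
  have htail := mergeSort_decreasing Job.slope (sorted.drop m)
  have hp := mergeSort_perm Job.slope (sorted.drop m)
  generalize (mergeSort Job.slope (sorted.drop m)).ret = tail at *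
  have ho : (sorted.take m ++ tail).Perm sorted :=
    (hp.append_left _).trans (.of_eq (List.take_append_drop m sorted))
  obtain ⟨σ, hσ⟩ := exists_perm_of_jobs (ho.trans (hs.trans hjs))
  have hσk : ∀ k : Fin n, (sorted.take m ++ tail)[k.val]? = some (jobOf f chat (σ k)) := by
    intro k; rw [hσ]; simp
  have hτk : ∀ k : Fin n, sorted[k.val]? = some (jobOf f chat (τ k)) := by
    intro k; rw [hτ]; simp
  have hlen : sorted.length = n := by rw [hτ]; simp
  refine ⟨σ, hσ, ⟨τ, fun a b hab => ?_, fun k hk => ?_⟩, fun k l hk hkl => ?_⟩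
  · simp only [linearized_self]
    rcases hab.eq_or_lt with rfl | hab
    · exact le_rfl
    have := List.pairwise_iff_getElem.1 hd a b (by omega) (by omega) hab
    simpa [hτ, jobOf] using this
  · have h1 := hσk k
    rw [List.getElem?_append_left (by simp; omega), List.getElem?_take_of_lt hk, hτk] at h1
    exact (congrArg Job.thread (Option.some.inj h1)).symm
  · simp only [linearized_self]
    rcases hkl.eq_or_lt with rfl | hkl
    · exact le_rfl
    have htl : (sorted.take m).length = m := by simp; omega
    have h1 := hσk k
    have h2 := hσk l
    rw [List.getElem?_append_right (by omega), htl] at h1 h2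
    obtain ⟨b1, e1⟩ := List.getElem?_eq_some_iff.1 h1
    obtain ⟨b2, e2⟩ := List.getElem?_eq_some_iff.1 h2
    have := List.pairwise_iff_getElem.1 htail (k - m) (l - m) b1 b2 (by
      have : (k : ℕ) < l := hkl
      omega)
    rw [e1, e2] at this
    exact this

lemma algorithm2_correct (hm : 0 < m) (hC : 0 < C) (hf : ∀ i, IsUtility C (f i)) :
    ∃ (chat : Fin n → ℕ) (σ : Equiv.Perm (Fin n)) (r : Fin n → Fin m) (c : Fin n → ℕ),
      (∃ price, Supported f m C chat price) ∧ IsRun m C f chat σ r c ∧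
      (algorithm2 m C f).ret =
        List.ofFn (fun k => ⟨σ k, chat (σ k), (r (σ k) : ℕ), c (σ k)⟩) := by
  obtain ⟨⟨price, hprice⟩, hthreads, -⟩ := galil_spec (m := m) hC hf
  obtain ⟨pick, hpick⟩ := exists_fun_of_perm_finRange Share.thread hthreads
  have hchat : ∀ s ∈ (galil m C f).ret, (pick s.thread).amount = s.amount := fun s hs => by
    rw [hpick s hs]
  have hjs := ret_jobs (f := f) (chat := fun i => (pick i).amount) hchat
  have hsup := hprice.supported (chat := fun i => (pick i).amount) hthreads hchat
  generalize (fun i => (pick i).amount) = chat at hjs hsup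
  obtain ⟨σ, hσ, hsort, hresort⟩ := order_spec (m := m)
    ((List.Perm.of_eq hjs).trans (hthreads.map (jobOf f chat)))
  obtain ⟨v, -, -, -, -⟩ := Heap.build_spec C 0 m
  obtain ⟨⟨Rs, js, h0, hlen, hrun⟩, -⟩ := assign_spec hm
    (List.ofFn fun k => jobOf f chat (σ k)) _ v _ (Heap.stores_build C m)
  have hrun' := fun k : Fin n => hrun k (jobOf f chat (σ k)) (by simp)
  refine ⟨chat, σ, fun i => js (σ.symm i),
    fun i => min (chat i) (Rs (σ.symm i) (js (σ.symm i))), ⟨price, hsup⟩,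
    ⟨hsort, hresort, Rs, fun j => congrFun h0 j, fun k => ?_⟩, ?_⟩
  · simp only [Equiv.symm_apply_apply]
    exact ⟨(hrun' k).1, trivial, (hrun' k).2.2⟩
  · simp only [algorithm2, ret_bind, ret_splitAt, ret_append]
    rw [hσ]
    refine List.ext_getElem? fun k => ?_
    rcases lt_or_ge k n with hk | hk
    · simpa [jobOf, hk] using (hrun' ⟨k, hk⟩).2.1
    · rw [List.getElem?_eq_none (by rw [hlen]; simpa using hk),
        List.getElem?_eq_none (by simpa using hk)]

lemma algorithm2_time_le (hm : 0 < m) (hmn : m ≤ n) (hC : 0 < C)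
    (hf : ∀ i, IsUtility C (f i)) : (algorithm2 m C f).time ≤
      n * ((2200 + 40 * C.size) * C.size + 10 * Nat.clog 2 n + 4 * m.size + 50) := by
  obtain ⟨-, hthreads, ht⟩ := galil_spec (m := m) hC hf
  have hlen : (galil m C f).ret.length = n := by simpa using hthreads.length_eq
  have hjobs : (jobs f (galil m C f).ret).ret.length = n := by
    have : ∀ l : List (Share n), (jobs f l).ret.length = l.length := fun l => by
      induction l with
      | nil => rfl
      | cons s l ih => simp [jobs, ih]
    rw [this, hlen]
  have hsorted : (mergeSort Job.value (jobs f (galil m C f).ret).ret).ret.length = n :=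
    (mergeSort_perm _ _).length_eq.trans hjobs
  have t1 := mergeSort_time_le Job.value (jobs f (galil m C f).ret).ret
  have t0 := time_jobs (f := f) (galil m C f).ret
  simp only [algorithm2, time_bind, ret_splitAt, ret_append, time_append]
  generalize (mergeSort Job.value (jobs f (galil m C f).ret).ret).ret = sorted at *
  have t2 := time_splitAt_le m sorted
  have t3 := mergeSort_time_le Job.slope (sorted.drop m)
  have hp := (mergeSort_perm Job.slope (sorted.drop m)).length_eq
  generalize (mergeSort Job.slope (sorted.drop m)).ret = tail at *
  obtain ⟨v, -, -, hd, hb⟩ := Heap.build_spec C 0 m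
  obtain ⟨-, t4⟩ := assign_spec hm (sorted.take m ++ tail) _ v _ (Heap.stores_build C m)
  have hol : (sorted.take m ++ tail).length = n := by
    simp only [List.length_append, List.length_take, hp, List.length_drop]
    omega
  have hdrop : (sorted.drop m).length * Nat.clog 2 (sorted.drop m).length ≤
      n * Nat.clog 2 n := by
    have : (sorted.drop m).length ≤ n := by simp; omega
    exact Nat.mul_le_mul this (Nat.clog_mono_right 2 this)
  have htake : (sorted.take m).length ≤ n := by simp; omega
  have hmul : (4 * (Heap.build C 0 m).ret.depth + 4) * n ≤ (4 * m.size + 4) * n :=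
    Nat.mul_le_mul_right _ (by omega)
  rw [hol] at t4
  rw [hjobs] at t1
  rw [hlen] at t0
  rw [hsorted] at t2
  -- The `46 * n` covers the linear costs of all phases, including building the heap in at most `7 *
  -- m + 1` steps, where `m ≤ n` enters; `1 ≤ n` absorbs the additive constants.
  have e : n * ((2200 + 40 * C.size) * C.size + 10 * Nat.clog 2 n + 4 * m.size + 50) =
      (2200 + 40 * C.size) * (n * C.size) + 10 * (n * Nat.clog 2 n) + (4 * m.size + 4) * n +
        46 * n := by ring
  omega

end Algorithm

/-! ### The asymptotic bound -/

lemma size_mul_log_two_le {k : ℕ} (hk : 0 < k) :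
    (k.size : ℝ) * Real.log 2 ≤ Real.log k + Real.log 2 := by
  have hs : 0 < k.size := Nat.size_pos.2 hk
  have h1 : 2 ^ (k.size - 1) ≤ k := Nat.lt_size.1 (by omega)
  have h2 : (2 : ℝ) ^ (k.size - 1) ≤ k := by exact_mod_cast h1
  have h3 := Real.log_le_log (by positivity) h2
  rw [Real.log_pow, Nat.cast_sub hs] at h3
  push_cast at h3
  linarith

lemma clog_two_le_size (k : ℕ) : Nat.clog 2 k ≤ k.size :=
  Nat.clog_le_of_le_pow (Nat.lt_size_self k).le

/-- Since `2 ≤ N`, both terms of `log k + log 2` are at most `log N`, and `2 / 0.69 < 3`. -/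
lemma size_le_three_mul_log {k N : ℕ} (hk : 0 < k) (hkN : k ≤ N) (hN : 2 ≤ N) :
    (k.size : ℝ) ≤ 3 * Real.log N := by
  have h1 := size_mul_log_two_le hk
  have h2 : Real.log k ≤ Real.log N :=
    Real.log_le_log (by exact_mod_cast hk) (by exact_mod_cast hkN)
  have h3 : Real.log 2 ≤ Real.log N := Real.log_le_log (by norm_num) (by exact_mod_cast hN)
  have h4 := Real.log_two_gt_d9
  have h5 : (k.size : ℝ) * 0.69 ≤ k.size * Real.log 2 :=
    mul_le_mul_of_nonneg_left (by linarith) (Nat.cast_nonneg _)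
  linarith

lemma algorithm2_time_le_log {m n C : ℕ} {f : Fin n → ℝ → ℝ} {K : ℝ} (hm : 0 < m) (hmn : m ≤ n)
    (hmC : 2 ≤ m * C) (hf : ∀ i, IsUtility C (f i))
    (hK : Real.log n ≤ K * Real.log ((m : ℝ) * C) ^ 2) :
    ((algorithm2 m C f).time : ℝ) ≤ (12000 + 20 * K) * (n * Real.log ((m : ℝ) * C) ^ 2) := by
  have hC : 0 < C := by
    rcases Nat.eq_zero_or_pos C with rfl | h
    · simp at hmC
    · exact h
  have ht : ((algorithm2 m C f).time : ℝ) ≤ n * ((2200 + 40 * C.size) * C.size +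
      10 * Nat.clog 2 n + 4 * m.size + 50) := by
    exact_mod_cast algorithm2_time_le hm hmn hC hf
  have s1 := size_le_three_mul_log hC (Nat.le_mul_of_pos_left C hm) hmC
  have s2 := size_le_three_mul_log hm (Nat.le_mul_of_pos_right m hC) hmC
  have hX : Real.log 2 ≤ Real.log ((m * C : ℕ) : ℝ) :=
    Real.log_le_log (by norm_num) (by exact_mod_cast hmC)
  have s3 := size_mul_log_two_le (hm.trans_le hmn)
  have s4 : (Nat.clog 2 n : ℝ) ≤ n.size := by exact_mod_cast clog_two_le_size n
  rw [← Nat.cast_mul] at hK ⊢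
  generalize Real.log ((m * C : ℕ) : ℝ) = X at *
  have l2 := Real.log_two_gt_d9
  have hX1 : 0.69 ≤ X := by linarith
  -- The bound `2 ≤ m * C` keeps `X` above `2 / 3`, so linear and constant terms are dominated by `X
  -- ^ 2`.
  have hXX : X ≤ 1.5 * X ^ 2 := by nlinarith
  have h1X : 1 ≤ 2.25 * X ^ 2 := by linarith
  have s5 : (n.size : ℝ) ≤ 1.5 * (K * X ^ 2) + 1 := by
    have hlog : 0 ≤ Real.log n := Real.log_natCast_nonneg n
    have : ((n.size : ℝ) - 1) * Real.log 2 ≤ Real.log n := by linarith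
    rcases le_or_gt (n.size : ℝ) 1 with h | h
    · linarith
    · have : ((n.size : ℝ) - 1) * 0.69 ≤ (n.size - 1) * Real.log 2 :=
        mul_le_mul_of_nonneg_left (by linarith) (by linarith)
      linarith
  -- The real `K` may be negative a priori; this sign permits rounding `15 * K` up to `20 * K` in
  -- the end.
  have hKX : 0 ≤ K * X ^ 2 := (Real.log_natCast_nonneg n).trans hK
  have s6 : (C.size : ℝ) * C.size ≤ 9 * X ^ 2 := by
    have := mul_le_mul s1 s1 (Nat.cast_nonneg _) (by linarith)
    linarith
  refine ht.trans ?_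
  rw [mul_left_comm]
  refine mul_le_mul_of_nonneg_left ?_ (Nat.cast_nonneg n)
  -- The contributions to the coefficient of `X ^ 2` are `2200 * 3 * 1.5 = 9900`, `40 * 9 = 360`, `4
  -- * 3 * 1.5 = 18` and `60 * 2.25 = 135`, within `12000`; sorting adds `10 * 1.5 * K`.
  linarith

end AA

theorem mainTheorem4 :
    (∀ (m n C : ℕ) (f : Fin n → ℝ → ℝ), 1 ≤ m → 1 ≤ C → (∀ i, AA.IsUtility C (f i)) →
      ∃ (chat : Fin n → ℕ) (σ : Equiv.Perm (Fin n)) (r : Fin n → Fin m) (c : Fin n → ℕ),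
        AA.IsSuperOptimal (Set.range (Nat.cast : ℕ → ℝ)) m C f (fun i => (chat i : ℝ)) ∧
        ((∀ i, AA.AffineOnUnits C (f i)) →
          AA.IsSuperOptimal Set.univ m C f (fun i => (chat i : ℝ))) ∧
        AA.IsRun m C f chat σ r c ∧
        (AA.algorithm2 m C f).ret =
          List.ofFn (fun k => ⟨σ k, chat (σ k), (r (σ k) : ℕ), c (σ k)⟩)) ∧
    (∀ K : ℝ, ∃ K' : ℝ, ∀ (m n C : ℕ) (f : Fin n → ℝ → ℝ),
      1 ≤ m → m ≤ n → 2 ≤ m * C → (∀ i, AA.IsUtility C (f i)) →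
      Real.log n ≤ K * Real.log ((m : ℝ) * C) ^ 2 →
      ((AA.algorithm2 m C f).time : ℝ) ≤ K' * (n * Real.log ((m : ℝ) * C) ^ 2)) := by
  refine ⟨fun m n C f hm hC hf => ?_, fun K => ⟨12000 + 20 * K, fun m n C f hm hmn hmC hf hK =>
    AA.algorithm2_time_le_log hm hmn hmC hf hK⟩⟩
  obtain ⟨chat, σ, r, c, ⟨price, hsup⟩, hrun, hret⟩ := AA.algorithm2_correct hm hC hf
  exact ⟨chat, σ, r, c, hsup.isSuperOptimal_units, hsup.isSuperOptimal_univ, hrun, hret⟩
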